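/- **Setting.** Strings are words $\mathbf a\in\Sigma^*$ over the alphabet $\Sigma=\{\mathtt 0,\mathtt 1,\mathtt{.}\}$ (binary digits and a separator), $|\mathbf a|$ is the length of $\mathbf a$, and $\mathcal B$ is the set of all functions $\Sigma^*\to\Sigma^*$. An *oracle machine* $M^?$ is a deterministic multi-tape Turing machine with an input tape, an output tape, an oracle query tape, an oracle answer tape and finitely many work tapes; in its oracle state, with oracle $\varphi\in\mathcal B$, it replaces in one step the content of the answer tape by $\varphi(\mathbf b)$, where $\mathbf b$ is the content of the query tape, without moving any head. $\mathrm{Time}_{M^?}(\varphi,\mathbf a)\in\mathbb N\cup\{\infty\}$ is the number of steps on input $\mathbf a$ with oracle $\varphi$. If $M^?$ halts on all inputs with oracle $\varphi$, then $M^\varphi\in\mathcal B$ is the function that maps each input to the resulting output. The class of *second-order polynomials* is the smallest class of maps $P:\mathbb N^{\mathbb N}\times\mathbb N\to\mathbb N$ that contains $(l,n)\mapsto p(n)$ for $p\in\mathbb N[X]$ and is closed under $P\mapsto\big((l,n)\mapsto l(P(l,n))\big)$, pointwise sums and pointwise products. **Codes.** An integer is coded by a sign bit followed by its binary expansion without leading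 zeros (strings with no digit after the sign code $0$). A dyadic number is coded by a code of an integer, the separator and binary digits after the point. The pairing $\langle\mathbf a,\mathbf b\rangle$ interleaves letter by letter three strings, all padded with zeros to the same length $\max\{|\mathbf a|,|\mathbf b|,\min\{|\mathbf a|,|\mathbf b|\}+2\}$: a control string consisting of $\min\{|\mathbf a|,|\mathbf b|\}$ ones, a zero, and a bit telling which of $\mathbf a,\mathbf b$ is longer; then $\mathbf a$; then $\mathbf b$. The interval $[r-\varepsilon,r+\varepsilon]$ ($r,\varepsilon$ dyadic, $\varepsilon\ge 0$) is coded by the pairing of a code of $r$ and a code of $\varepsilon$, and the infinite interval $[-\infty,\infty]$ by the empty string. **Interval reals.** A function $\varphi\in\mathcal B$ is a *name* of $x\in\mathbb R$ if there are intervals $I_0\supseteq I_1\supseteq\cdots$, each a finite dyadic interval or $[-\infty,\infty]$, with $\bigcap_n I_n=\{x\}$, such that $\varphi$ maps every code of the integer $2^n$ to a code of $I_n$, for all $n$. The *parameter* of such a name is $$\mu(\varphi)(n)=\min\{N\mid \operatorname{diam}(I_N)\le 2^{-n}\}+\lceil\log_2(|x|+1)\rceil .$$ $\mathbb R_i$ denotes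 $\mathbb R$ with these names and this parameter. A machine $M^?$ *computes* a partial function $f:\subseteq\mathbb R\to\mathbb R$ if, for every name $\varphi$ of a point $x\in\operatorname{dom}f$, $M^\varphi$ is defined and is a name of $f(x)$. The partial function $f:\subseteq\mathbb R_i\to\mathbb R_i$ is *polytime computable* if there are a machine $N^?$ computing $f$ and second-order polynomials $P_0,Q_0$ such that, for all names $\varphi$ of points of $\operatorname{dom}f$, all $\mathbf a\in\Sigma^*$ and all $n\in\mathbb N$, $$\mathrm{Time}_{N^?}(\varphi,\mathbf a)\le P_0(\mu(\varphi),|\mathbf a|)\quad\text{and}\quad \mu(N^\varphi)(n)\le Q_0(\mu(\varphi),n).$$ **Theorem.** Whenever $f:\subseteq\mathbb R_i\to\mathbb R_i$ is polytime computable, there are an oracle machine $M^?$ that computes $f$, a constant $C\in\mathbb N$ and a second-order polynomial $P$ such that $$\mathrm{Time}_{M^?}(\varphi,\mathbf a)\le C\cdot|\mathbf a|+C\qquad\text{for all }\varphi\in\mathcal B\text{ and all }\mathbf a\in\Sigma^*,$$ and $$\mu(M^\varphi)(n)\le P(\mu(\varphi),n)\qquad\text{for all names }\varphi\text{ of points of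 }\operatorname{dom}f\text{ and all }n\in\mathbb N.$$ -/

import Mathlib

/-! ### Strings and oracles -/

/-- The alphabet: the two binary digits and the separator (the binary point). -/
inductive Letter
  | zero
  | one
  | sep

/-- The space of all string functions (the oracles). -/
abbrev StringFun : Type := List Letter → List Letter

/-! ### Oracle Turing machines -/

/-- The tapes of an oracle machine: input, output, oracle query, oracle answer, and work tapes. -/
inductive TapeName (W : Type)
  | input
  | output
  | query
  | answer
  | work (w : W)

/-- Movement of a head in one step. -/
inductive HeadMove
  | left
  | stay
  | right

def HeadMove.toInt : HeadMove → ℤ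
  | .left => -1
  | .stay => 0
  | .right => 1

/-- Contents of a tape cell: blank (`none`), a letter, or one of the machine's auxiliary symbols. -/
abbrev TapeCell (A : Type) : Type := Option (Letter ⊕ A)

/-- A deterministic multi-tape oracle Turing machine with two-way infinite tapes.
`ask` is the oracle state; after an oracle call the machine continues in the state `resume`. -/
structure OracleMachine where
  State : Type
  Aux : Type
  Work : Type
  finite_state : Finite State
  finite_aux : Finite Aux
  finite_work : Finite Work
  start : State
  ask : State
  resume : State
  halt : State
  /-- From the state and the scanned cells: the new state, the cells written, the head moves. -/
  trans : State → (TapeName Work → TapeCell Aux) →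
    State × (TapeName Work → TapeCell Aux × HeadMove)

/-- The letter in a cell, if it holds a letter. -/
def TapeCell.letter {A : Type} : TapeCell A → Option Letter
  | some (.inl s) => some s
  | _ => none

/-- The tape with the string `s` in the cells `0, 1, 2, …` and blanks elsewhere. -/
def writtenTape {A : Type} (s : List Letter) : ℤ → TapeCell A
  | .ofNat i => (s[i]?).map Sum.inl
  | .negSucc _ => none

open Classical in
/-- The content of a tape: the letters in the cells `0, 1, 2, …` up to the first cell that does not
hold a letter. (On the tapes that occur in computations there always is such a cell.) -/
noncomputable def tapeContent {A : Type} (T : ℤ → TapeCell A) : List Letter :=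
  if h : ∃ n : ℕ, (T n).letter = none then
    (List.range (Nat.find h)).filterMap fun i : ℕ => (T i).letter
  else []

namespace OracleMachine

structure Config (M : OracleMachine) where
  state : M.State
  tape : TapeName M.Work → ℤ → TapeCell M.Aux
  head : TapeName M.Work → ℤ

/-- Initially the input is on the input tape, all other tapes are blank, all heads are at `0`. -/
def init (M : OracleMachine) (a : List Letter) : M.Config where
  state := M.start
  tape
    | .input => writtenTape a
    | _ => fun _ => none
  head _ := 0

open Classical in
/-- One step with oracle `φ`. In the oracle state, the step replaces the content of the answer tape
by the value of `φ` on the content of the query tape, and no head moves. -/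
noncomputable def step (M : OracleMachine) (φ : StringFun) (c : M.Config) : M.Config :=
  if c.state = M.halt then c
  else if c.state = M.ask then
    { state := M.resume
      tape := fun
        | .answer => writtenTape (φ (tapeContent (c.tape .query)))
        | t => c.tape t
      head := c.head }
  else
    let r := M.trans c.state fun t => c.tape t (c.head t)
    { state := r.1
      tape := fun t => Function.update (c.tape t) (c.head t) (r.2 t).1
      head := fun t => c.head t + (r.2 t).2.toInt }

/-- The configuration after `n` steps on input `a` with oracle `φ`. -/
noncomputable def run (M : OracleMachine) (φ : StringFun) (a : List Letter) (n : ℕ) : M.Config :=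
  (M.step φ)^[n] (M.init a)

def HaltsAfter (M : OracleMachine) (φ : StringFun) (a : List Letter) (n : ℕ) : Prop :=
  (M.run φ a n).state = M.halt

/-- The number of steps on input `a` with oracle `φ`; it is `⊤` if the machine does not halt. -/
noncomputable def time (M : OracleMachine) (φ : StringFun) (a : List Letter) : ℕ∞ :=
  ⨅ (n : ℕ) (_ : M.HaltsAfter φ a n), (n : ℕ∞)

open Classical in
/-- The partial operator computed by the machine: it is defined at the oracles with which the
machine halts on every input, and its value is the function mapping an input to the final content of
the output tape. -/
noncomputable def operator (M : OracleMachine) : StringFun →. StringFun := fun φ =>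
  { Dom := ∀ a, ∃ n, M.HaltsAfter φ a n
    get := fun h a => tapeContent ((M.run φ a (Nat.find (h a))).tape .output) }

end OracleMachine

/-! ### Second-order polynomials -/

/-- The smallest class of functionals that contains the polynomials in the number argument and is
closed under application of the function argument, sums and products. -/
inductive IsSecondOrderPolynomial : ((ℕ → ℕ) → ℕ → ℕ) → Prop
  | poly (p : Polynomial ℕ) : IsSecondOrderPolynomial fun _ n => p.eval n
  | app {P : (ℕ → ℕ) → ℕ → ℕ} :
      IsSecondOrderPolynomial P → IsSecondOrderPolynomial fun l n => l (P l n)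
  | add {P Q : (ℕ → ℕ) → ℕ → ℕ} : IsSecondOrderPolynomial P → IsSecondOrderPolynomial Q →
      IsSecondOrderPolynomial fun l n => P l n + Q l n
  | mul {P Q : (ℕ → ℕ) → ℕ → ℕ} : IsSecondOrderPolynomial P → IsSecondOrderPolynomial Q →
      IsSecondOrderPolynomial fun l n => P l n * Q l n

/-! ### Preparametrised spaces and polynomial-time computability -/

/-- A set with a representation (a partial surjection from the string functions) and a parameter
assigning to each name a non-decreasing function. Values of `param` outside the domain of `rep` are
irrelevant. -/
structure PreparametrisedSpace (X : Type*) where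
  rep : StringFun →. X
  rep_surjective : ∀ x, ∃ φ, x ∈ rep φ
  param : StringFun → ℕ → ℕ
  param_mono : ∀ φ, (rep φ).Dom → ∀ n, param φ n ≤ param φ (n + 1)

/-- `F` is a realiser of the partial function `f`: it maps names of points `x` in the domain of `f`
to names of `f x`. -/
def IsRealiser {X Y : Type*} (SX : PreparametrisedSpace X) (SY : PreparametrisedSpace Y)
    (F : StringFun →. StringFun) (f : X →. Y) : Prop :=
  ∀ φ x y, x ∈ SX.rep φ → y ∈ f x → ∃ ψ ∈ F φ, y ∈ SY.rep ψ

/-- `Q` bounds the parameter blowup of `M` on the names of points in the domain of `f`. -/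
def BlowupBoundedBy {X Y : Type*} (SX : PreparametrisedSpace X) (SY : PreparametrisedSpace Y)
    (M : OracleMachine) (f : X →. Y) (Q : (ℕ → ℕ) → ℕ → ℕ) : Prop :=
  ∀ φ x, x ∈ SX.rep φ → (f x).Dom →
    ∀ ψ ∈ M.operator φ, ∀ n, SY.param ψ n ≤ Q (SX.param φ) n

/-- Polynomial-time computability of a partial function between preparametrised spaces. -/
def IsPolytimeComputable {X Y : Type*} (SX : PreparametrisedSpace X) (SY : PreparametrisedSpace Y)
    (f : X →. Y) : Prop :=
  ∃ (M : OracleMachine) (P Q : (ℕ → ℕ) → ℕ → ℕ),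
    IsSecondOrderPolynomial P ∧ IsSecondOrderPolynomial Q ∧
    IsRealiser SX SY M.operator f ∧
    (∀ φ x, x ∈ SX.rep φ → (f x).Dom → ∀ a, M.time φ a ≤ (P (SX.param φ) a.length : ℕ∞)) ∧
    BlowupBoundedBy SX SY M f Q

/-! ### Codes of integers, dyadic numbers and dyadic intervals -/

def Letter.ofBit : Bool → Letter
  | false => .zero
  | true => .one

/-- The number with the given binary digits, most significant digit first. -/
def binaryValue (w : List Bool) : ℕ := w.foldl (fun v b => 2 * v + b.toNat) 0

/-- `SignedCode c s m`: the string `c` consists of a sign bit `s` (`true` means negative) and the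
binary expansion of `m` without leading zeros. A string without a digit after the sign codes zero. -/
inductive SignedCode : List Letter → Bool → ℕ → Prop
  | empty : SignedCode [] false 0
  | sign (s : Bool) : SignedCode [Letter.ofBit s] s 0
  | digits (s : Bool) (w : List Bool) :
      SignedCode (Letter.ofBit s :: Letter.one :: w.map Letter.ofBit) s (binaryValue (true :: w))

/-- The string `a` is a code of the integer `z`. -/
def IsIntCode (a : List Letter) (z : ℤ) : Prop :=
  ∃ s m, SignedCode a s m ∧ z = if s then -(m : ℤ) else m

/-- The string `a` is a code of the dyadic number `q`: an integer code, the separator, and the binary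
digits after the point. -/
def IsDyadicCode (a : List Letter) (q : ℚ) : Prop :=
  ∃ c s m, ∃ w : List Bool, SignedCode c s m ∧ a = c ++ Letter.sep :: w.map Letter.ofBit ∧
    q = (if s then -1 else 1) * (m + binaryValue w / 2 ^ w.length)

def interleave : List Letter → List Letter → List Letter → List Letter
  | x :: u, y :: v, z :: w => x :: y :: z :: interleave u v w
  | _, _, _ => []

/-- Append zeros up to the length `L`. -/
def padTo (L : ℕ) (a : List Letter) : List Letter := a ++ List.replicate (L - a.length) Letter.zero

/-- The pairing of strings: the first of three interleaved tracks consists of as many ones as the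
shorter string has letters, a zero, a bit telling which string is longer, and zeros; the other two
tracks are the strings. All tracks are padded with zeros to equal length. -/
def pairString (a b : List Letter) : List Letter :=
  let m := min a.length b.length
  let L := max (max a.length b.length) (m + 2)
  interleave
    (padTo L (List.replicate m Letter.one ++
      [Letter.zero, Letter.ofBit (decide (a.length < b.length))]))
    (padTo L a) (padTo L b)

/-- An interval: the infinite one, or `[r - ε, r + ε]`. (Only those with dyadic `r` and `ε ≥ 0` have
codes.) -/
inductive CodedInterval
  | infinite
  | finite (r ε : ℚ)

namespace CodedInterval

/-- The real numbers in the interval. -/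
def toSet : CodedInterval → Set ℝ
  | infinite => Set.univ
  | finite r ε => Set.Icc ((r : ℝ) - ε) (r + ε)

def diam : CodedInterval → WithTop ℚ
  | infinite => ⊤
  | finite _ ε => ((2 * ε : ℚ) : WithTop ℚ)

end CodedInterval

/-- `IsIntervalCode s I`: the string `s` is a code of `I`. The empty string codes the infinite
interval; a pair of codes of `r` and `ε ≥ 0` codes `[r - ε, r + ε]`. -/
inductive IsIntervalCode : List Letter → CodedInterval → Prop
  | infinite : IsIntervalCode [] CodedInterval.infinite
  | finite {a b : List Letter} {r ε : ℚ} : IsDyadicCode a r → IsDyadicCode b ε → 0 ≤ ε →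
      IsIntervalCode (pairString a b) (CodedInterval.finite r ε)

/-! ### The preparametrised space of interval reals -/

/-- The string function `ψ` encodes the sequence `I` of intervals; the index `n` is given by the
integer `2 ^ n`, that is, in unary. -/
def EncodesIntervals (ψ : StringFun) (I : ℕ → CodedInterval) : Prop :=
  ∀ n a, IsIntCode a (2 ^ n) → IsIntervalCode (ψ a) (I n)

/-- `ψ` is a name of the real number `x`: it encodes a nested sequence of intervals whose intersection
is `{x}`. -/
def IsIntervalName (ψ : StringFun) (x : ℝ) : Prop :=
  ∃ I, EncodesIntervals ψ I ∧ (∀ n, (I (n + 1)).toSet ⊆ (I n).toSet) ∧ ⋂ n, (I n).toSet = {x}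

/-- The interval representation of the real numbers, as a partial function
(see `mem_intervalRep`). -/
noncomputable def intervalRep : StringFun →. ℝ := fun ψ =>
  { Dom := ∃ x, IsIntervalName ψ x
    get := fun h => h.choose }

open Classical in
/-- The parameter of a name of `x`: the least index at which the encoded interval has diameter at most
`2⁻ⁿ`, plus `⌈log₂ (|x| + 1)⌉`. -/
noncomputable def intervalParam (ψ : StringFun) (n : ℕ) : ℕ :=
  sInf {N | ∃ I, EncodesIntervals ψ I ∧ (I N).diam ≤ (((2 : ℚ) ^ n)⁻¹ : ℚ)} +
    ⌈Real.logb 2 (|(intervalRep ψ).getOrElse 0| + 1)⌉₊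

theorem binaryValue_append (w : List Bool) (b : Bool) :
    binaryValue (w ++ [b]) = 2 * binaryValue w + b.toNat := by
  simp [binaryValue]

theorem binaryValue_append_zeros (w : List Bool) (k : ℕ) :
    binaryValue (w ++ List.replicate k false) = binaryValue w * 2 ^ k := by
  induction k with
  | zero => simp
  | succ k ih =>
    rw [List.replicate_succ', ← List.append_assoc, binaryValue_append, ih]
    simp; ring

theorem binaryValue_bounds (w : List Bool) :
    2 ^ w.length ≤ binaryValue (true :: w) ∧ binaryValue (true :: w) < 2 ^ (w.length + 1) := by
  induction w using List.reverseRecOn with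
  | nil => simp [binaryValue]
  | append_singleton w b ih =>
    rw [← List.cons_append, binaryValue_append]
    have hb : b.toNat ≤ 1 := by cases b <;> simp
    simp only [List.length_append, List.length_singleton, pow_succ] at *
    omega

theorem isIntCode_two_pow (n : ℕ) :
    IsIntCode (Letter.zero :: Letter.one :: List.replicate n Letter.zero) (2 ^ n) := by
  refine ⟨false, binaryValue (true :: List.replicate n false), ?_, ?_⟩
  · have := SignedCode.digits false (List.replicate n false)
    simpa [Letter.ofBit] using this
  · have := binaryValue_append_zeros [true] n
    simp only [List.singleton_append] at this
    rw [this]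
    simp [binaryValue]

theorem IsIntCode.length_eq {a : List Letter} {n : ℕ} (h : IsIntCode a (2 ^ n)) :
    a.length = n + 2 := by
  obtain ⟨s, m, hc, hz⟩ := h
  have hpos : (0 : ℤ) < 2 ^ n := by positivity
  cases hc with
  | empty => simp at hz
  | sign s => cases s <;> simp at hz
  | digits s w =>
    obtain ⟨h1, h2⟩ := binaryValue_bounds w
    cases s with
    | true => simp only [if_true] at hz; omega
    | false =>
      have hz' : 2 ^ n = binaryValue (true :: w) := by
        simp only [Bool.false_eq_true, if_false] at hz; exact_mod_cast hz
      rw [← hz'] at h1 h2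
      have h3 := (Nat.pow_le_pow_iff_right (by norm_num : 1 < 2)).1 h1
      have h4 := (Nat.pow_lt_pow_iff_right (by norm_num : 1 < 2)).1 h2
      simp only [List.length_cons, List.length_map]
      omega

theorem Letter.ofBit_injective : Function.Injective Letter.ofBit := by
  intro a b; cases a <;> cases b <;> simp [Letter.ofBit]

theorem SignedCode.functional {c : List Letter} {s s' : Bool} {m m' : ℕ}
    (h : SignedCode c s m) (h' : SignedCode c s' m') : s = s' ∧ m = m' := by
  generalize hc : c = c' at h'
  cases h <;> cases h' <;> simp only [List.cons.injEq, reduceCtorEq, and_false] at hc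
  · exact ⟨rfl, rfl⟩
  · exact ⟨Letter.ofBit_injective hc.1, rfl⟩
  · exact ⟨Letter.ofBit_injective hc.1,
      by rw [List.map_injective_iff.2 Letter.ofBit_injective hc.2.2]⟩

theorem SignedCode.sep_notMem {c : List Letter} {s : Bool} {m : ℕ} (h : SignedCode c s m) :
    Letter.sep ∉ c := by
  have ofBit_ne : ∀ b, Letter.sep ≠ Letter.ofBit b := by
    intro b; cases b <;> simp [Letter.ofBit]
  cases h with
  | empty => simp
  | sign s => simpa using ofBit_ne s
  | digits s w => simp [ofBit_ne, fun b => (ofBit_ne b).symm]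

theorem IsDyadicCode.functional {a : List Letter} {q q' : ℚ}
    (h : IsDyadicCode a q) (h' : IsDyadicCode a q') : q = q' := by
  obtain ⟨c, s, m, w, hc, ha, hq⟩ := h
  obtain ⟨c', s', m', w', hc', ha', hq'⟩ := h'
  have key : ∀ (u u' v v' : List Letter), Letter.sep ∉ u → Letter.sep ∉ u' →
      u ++ Letter.sep :: v = u' ++ Letter.sep :: v' → u = u' ∧ v = v' := by
    intro u
    induction u with
    | nil =>
      intro u' v v' _ h2 h
      cases u' with
      | nil => simpa using h
      | cons x u' => simp at h h2; exact absurd h.1 h2.1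
    | cons y u ih =>
      intro u' v v' h1 h2 h
      cases u' with
      | nil => simp at h h1; exact absurd h.1.symm h1.1
      | cons x u' =>
        simp only [List.cons_append, List.cons.injEq, List.mem_cons, not_or] at h h1 h2
        obtain ⟨e1, e2⟩ := ih u' v v' h1.2 h2.2 h.2
        exact ⟨by rw [h.1, e1], e2⟩
  obtain ⟨e1, e2⟩ := key _ _ _ _ hc.sep_notMem hc'.sep_notMem (ha.symm.trans ha')
  subst e1
  obtain ⟨rfl, rfl⟩ := hc.functional hc'
  rw [hq, hq', List.map_injective_iff.2 Letter.ofBit_injective e2]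

theorem IsDyadicCode.padTo {a : List Letter} {q : ℚ} (h : IsDyadicCode a q) (L : ℕ) :
    IsDyadicCode (padTo L a) q := by
  obtain ⟨c, s, m, w, hc, ha, hq⟩ := h
  refine ⟨c, s, m, w ++ List.replicate (L - a.length) false, hc, ?_, ?_⟩
  · rw [_root_.padTo]
    conv_lhs => rw [ha]
    subst ha
    simp [Letter.ofBit]
  · rw [hq, binaryValue_append_zeros]
    simp only [List.length_append, List.length_replicate, pow_add]
    push_cast
    rw [mul_div_mul_right _ _ (by positivity)]

theorem interleave_injective {u v w u' v' w' : List Letter} (hv : u.length = v.length)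
    (hw : u.length = w.length) (hv' : u'.length = v'.length) (hw' : u'.length = w'.length)
    (h : interleave u v w = interleave u' v' w') : v = v' ∧ w = w' := by
  induction u generalizing v w u' v' w' with
  | nil =>
    obtain rfl : v = [] := List.length_eq_zero_iff.1 hv.symm
    obtain rfl : w = [] := List.length_eq_zero_iff.1 hw.symm
    match u', v', w' with
    | [], v', w' =>
      exact ⟨(List.length_eq_zero_iff.1 hv'.symm).symm, (List.length_eq_zero_iff.1 hw'.symm).symm⟩
    | x :: u', y :: v', z :: w' => simp [interleave] at h
    | x :: u', [], w' => simp at hv'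
    | x :: u', y :: v', [] => simp at hw'
  | cons x u ih =>
    match v, w with
    | [], w => simp at hv
    | y :: v, [] => simp at hw
    | y :: v, z :: w =>
      match u', v', w' with
      | [], v', w' => simp [interleave] at h
      | x :: u', [], w' => simp at hv'
      | x :: u', y :: v', [] => simp at hw'
      | x' :: u', y' :: v', z' :: w' =>
        simp only [interleave, List.cons.injEq] at h
        simp only [List.length_cons, Nat.add_right_cancel_iff] at hv hw hv' hw'
        obtain ⟨e1, e2⟩ := ih hv hw hv' hw' h.2.2.2
        exact ⟨by rw [h.2.1, e1], by rw [h.2.2.1, e2]⟩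

theorem length_padTo {L : ℕ} {a : List Letter} (h : a.length ≤ L) : (padTo L a).length = L := by
  simp [padTo]; omega

theorem pairString_ne_nil (a b : List Letter) : pairString a b ≠ [] := by
  have h : ∀ u v w : List Letter, u ≠ [] → v ≠ [] → w ≠ [] → interleave u v w ≠ [] := by
    intro u v w hu hv hw
    match u, v, w, hu, hv, hw with
    | _ :: _, _ :: _, _ :: _, _, _, _ => simp [interleave]
  have h2 : ∀ L c, c.length ≤ L → 0 < L → padTo L c ≠ [] := by
    intro L c h1 h2 h3
    have := length_padTo h1
    rw [h3] at this
    simp at this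
    omega
  apply h <;> apply h2
  all_goals first | omega | simp

theorem IsIntervalCode.functional {s : List Letter} {I I' : CodedInterval}
    (h : IsIntervalCode s I) (h' : IsIntervalCode s I') : I = I' := by
  generalize hs : s = s' at h'
  cases h with
  | infinite =>
    cases h' with
    | infinite => rfl
    | finite => exact absurd hs.symm (pairString_ne_nil _ _)
  | @finite a b r ε ha hb hε =>
    cases h' with
    | infinite => exact absurd hs (pairString_ne_nil _ _)
    | @finite a' b' r' ε' ha' hb' hε' =>
      rw [pairString, pairString] at hs
      have len : ∀ (a b : List Letter) (x : Letter),
          let L := max (max a.length b.length) (min a.length b.length + 2)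
          (padTo L (List.replicate (min a.length b.length) Letter.one ++
            [Letter.zero, x])).length = L ∧
          (padTo L a).length = L ∧ (padTo L b).length = L := by
        intro a b x
        refine ⟨length_padTo ?_, length_padTo ?_, length_padTo ?_⟩
        · simp
        · simp
        · simp
      obtain ⟨l1, l2, l3⟩ := len a b (Letter.ofBit (decide (a.length < b.length)))
      obtain ⟨l1', l2', l3'⟩ := len a' b' (Letter.ofBit (decide (a'.length < b'.length)))
      obtain ⟨e1, e2⟩ := interleave_injective (l1.trans l2.symm) (l1.trans l3.symm)
        (l1'.trans l2'.symm) (l1'.trans l3'.symm) hs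
      rw [(ha.padTo _).functional (e1 ▸ ha'.padTo _), (hb.padTo _).functional (e2 ▸ hb'.padTo _)]

theorem EncodesIntervals.functional {ψ : StringFun} {I I' : ℕ → CodedInterval}
    (h : EncodesIntervals ψ I) (h' : EncodesIntervals ψ I') : I = I' :=
  funext fun n => (h n _ (isIntCode_two_pow n)).functional (h' n _ (isIntCode_two_pow n))

theorem IsIntervalName.functional {ψ : StringFun} {x y : ℝ}
    (h : IsIntervalName ψ x) (h' : IsIntervalName ψ y) : x = y := by
  obtain ⟨I, hI, -, hx⟩ := h
  obtain ⟨J, hJ, -, hy⟩ := h'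
  rw [hI.functional hJ] at hx
  exact Set.singleton_injective (hx.symm.trans hy)

theorem mem_intervalRep {ψ : StringFun} {x : ℝ} : x ∈ intervalRep ψ ↔ IsIntervalName ψ x :=
  ⟨fun ⟨h, e⟩ => e ▸ h.choose_spec, fun h => ⟨⟨x, h⟩, (Exists.choose_spec ⟨x, h⟩ :
    IsIntervalName ψ _).functional h⟩⟩

theorem exists_binaryValue_eq (m : ℕ) : m = 0 ∨ ∃ w, binaryValue (true :: w) = m := by
  induction m using Nat.strong_induction_on with
  | _ m ih =>
    rcases Nat.eq_zero_or_pos m with h0 | h0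
    · exact .inl h0
    right
    rcases ih (m / 2) (by omega) with h | ⟨w, hw⟩
    · exact ⟨[], by simp [binaryValue]; omega⟩
    · refine ⟨w ++ [decide (m % 2 = 1)], ?_⟩
      rw [← List.cons_append, binaryValue_append, hw]
      rcases Nat.mod_two_eq_zero_or_one m with h | h <;> simp [h] <;> omega

theorem exists_binaryValue_eq_of_lt (n j : ℕ) (h : j < 2 ^ n) :
    ∃ w, w.length = n ∧ binaryValue w = j := by
  induction n generalizing j with
  | zero => exact ⟨[], rfl, by simp [binaryValue] at *; omega⟩
  | succ n ih =>
    obtain ⟨w, hl, hw⟩ := ih (j / 2) (by rw [pow_succ] at h; omega)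
    refine ⟨w ++ [decide (j % 2 = 1)], by simp [hl], ?_⟩
    rw [binaryValue_append, hw]
    rcases Nat.mod_two_eq_zero_or_one j with h | h <;> simp [h] <;> omega

theorem exists_isDyadicCode (k : ℤ) (n : ℕ) : ∃ a, IsDyadicCode a ((k : ℚ) / 2 ^ n) := by
  set j := k.natAbs with hj
  have hcode : ∀ s, ∃ c, ∃ s', SignedCode c s' (j / 2 ^ n) ∧ s' = s := by
    intro s
    rcases exists_binaryValue_eq (j / 2 ^ n) with h | ⟨w, hw⟩
    · exact ⟨_, _, h ▸ SignedCode.sign s, rfl⟩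
    · exact ⟨_, _, hw ▸ SignedCode.digits s w, rfl⟩
  obtain ⟨c, s, hc, hs⟩ := hcode (decide (k < 0))
  obtain ⟨w, hl, hw⟩ := exists_binaryValue_eq_of_lt n (j % 2 ^ n) (Nat.mod_lt _ (by positivity))
  refine ⟨_, c, s, _, w, hc, rfl, ?_⟩
  have h1 : (j : ℚ) = 2 ^ n * (j / 2 ^ n : ℕ) + (j % 2 ^ n : ℕ) := by
    exact_mod_cast (Nat.div_add_mod j (2 ^ n)).symm
  have h2 : ((j / 2 ^ n : ℕ) : ℚ) + (j % 2 ^ n : ℕ) / 2 ^ n = j / 2 ^ n := by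
    rw [h1]; field_simp
  rw [hw, hl, h2, hs]
  have h3 : (k : ℚ) = (if decide (k < 0) then -1 else 1) * (j : ℚ) := by
    by_cases hk : k < 0
    · have : (k : ℤ) = -(j : ℤ) := by omega
      simp only [hk, decide_true, if_true]
      rw [this]; push_cast; ring
    · have : (k : ℤ) = (j : ℤ) := by omega
      simp only [hk, decide_false]
      rw [this]; push_cast; simp
  rw [h3, mul_div_assoc]

theorem exists_isIntervalName (x : ℝ) : ∃ ψ, IsIntervalName ψ x := by
  have hcode : ∀ n : ℕ, ∃ s, IsIntervalCode s
      (.finite (((2 * ⌊x * 2 ^ n⌋ + 1 : ℤ) : ℚ) / 2 ^ (n + 1)) (((1 : ℤ) : ℚ) / 2 ^ (n + 1))) := by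
    intro n
    obtain ⟨a, ha⟩ := exists_isDyadicCode (2 * ⌊x * 2 ^ n⌋ + 1) (n + 1)
    obtain ⟨b, hb⟩ := exists_isDyadicCode 1 (n + 1)
    exact ⟨_, .finite ha hb (by positivity)⟩
  choose s hs using hcode
  have hset : ∀ n : ℕ, (CodedInterval.finite (((2 * ⌊x * 2 ^ n⌋ + 1 : ℤ) : ℚ) / 2 ^ (n + 1))
      (((1 : ℤ) : ℚ) / 2 ^ (n + 1))).toSet =
      Set.Icc ((⌊x * 2 ^ n⌋ : ℝ) / 2 ^ n) ((⌊x * 2 ^ n⌋ + 1 : ℝ) / 2 ^ n) := by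
    intro n
    simp only [CodedInterval.toSet]
    congr 1 <;> push_cast <;> rw [pow_succ] <;> field_simp <;> ring
  have hmem : ∀ n : ℕ, (⌊x * 2 ^ n⌋ : ℝ) / 2 ^ n ≤ x ∧ x ≤ (⌊x * 2 ^ n⌋ + 1 : ℝ) / 2 ^ n := by
    intro n
    have hp : (0 : ℝ) < 2 ^ n := by positivity
    exact ⟨(div_le_iff₀ hp).2 (Int.floor_le _), (le_div_iff₀ hp).2 (Int.lt_floor_add_one _).le⟩
  refine ⟨fun a => s (a.length - 2), fun n => .finite (((2 * ⌊x * 2 ^ n⌋ + 1 : ℤ) : ℚ) / 2 ^ (n + 1))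
      (((1 : ℤ) : ℚ) / 2 ^ (n + 1)), fun n a ha => ?_, fun n => ?_, ?_⟩
  · simpa only [ha.length_eq, Nat.add_sub_cancel] using hs n
  · simp only [hset]
    have e : x * 2 ^ (n + 1) = 2 * (x * 2 ^ n) := by ring
    have h1 := Int.floor_le (x * 2 ^ n)
    have h2 := Int.lt_floor_add_one (x * 2 ^ n)
    have h3 : 2 * ⌊x * 2 ^ n⌋ ≤ ⌊x * 2 ^ (n + 1)⌋ := by
      rw [Int.le_floor, e]; push_cast; linarith
    have h4 : ⌊x * 2 ^ (n + 1)⌋ < 2 * ⌊x * 2 ^ n⌋ + 2 := by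
      rw [Int.floor_lt, e]; push_cast; linarith
    have h3' : (2 * ⌊x * 2 ^ n⌋ : ℝ) ≤ ⌊x * 2 ^ (n + 1)⌋ := by exact_mod_cast h3
    have h4' : (⌊x * 2 ^ (n + 1)⌋ : ℝ) + 1 ≤ 2 * ⌊x * 2 ^ n⌋ + 2 := by
      exact_mod_cast (by omega : ⌊x * 2 ^ (n + 1)⌋ + 1 ≤ 2 * ⌊x * 2 ^ n⌋ + 2)
    clear h3 h4 h1 h2
    generalize ⌊x * 2 ^ (n + 1)⌋ = k at *
    apply Set.Icc_subset_Icc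
    · rw [pow_succ, div_le_div_iff₀ (by positivity) (by positivity)]
      have hp : (0 : ℝ) < 2 ^ n := by positivity
      nlinarith
    · rw [pow_succ, div_le_div_iff₀ (by positivity) (by positivity)]
      have hp : (0 : ℝ) < 2 ^ n := by positivity
      nlinarith
  · ext y
    simp only [hset, Set.mem_iInter, Set.mem_Icc, Set.mem_singleton_iff]
    constructor
    · intro hy
      by_contra hne
      have hpos : 0 < |y - x| := abs_pos.2 (sub_ne_zero.2 hne)
      obtain ⟨n, hn⟩ := exists_pow_lt_of_lt_one hpos (by norm_num : (1 / 2 : ℝ) < 1)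
      have h1 := hy n
      have h2 := hmem n
      have h3 : (⌊x * 2 ^ n⌋ + 1 : ℝ) / 2 ^ n = (⌊x * 2 ^ n⌋ : ℝ) / 2 ^ n + (1 / 2) ^ n := by
        rw [add_div, one_div_pow]
      have : |y - x| ≤ (1 / 2) ^ n := by
        rw [abs_le]; constructor <;> linarith [h1.1, h1.2, h2.1, h2.2]
      linarith
    · rintro rfl
      exact hmem

theorem IsIntervalName.exists_diam_le {I : ℕ → CodedInterval} {x : ℝ}
    (hnest : ∀ n, (I (n + 1)).toSet ⊆ (I n).toSet) (hx : ⋂ n, (I n).toSet = {x}) {δ : ℚ}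
    (hδ : 0 < δ) : ∃ N, (I N).diam ≤ (δ : WithTop ℚ) := by
  by_contra! hcon
  have hanti : Antitone fun n => (I n).toSet := antitone_nat_of_succ_le hnest
  have hmem : ∀ n, x ∈ (I n).toSet := fun n =>
    Set.mem_iInter.1 (hx ▸ Set.mem_singleton x : x ∈ ⋂ n, (I n).toSet) n
  have hδ' : (0 : ℝ) < δ := by exact_mod_cast hδ
  have hor : ∀ n, x + δ / 2 ∈ (I n).toSet ∨ x - δ / 2 ∈ (I n).toSet := by
    intro n
    have h1 := hmem n
    have h2 := hcon n
    cases hI : I n with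
    | infinite => left; simp [CodedInterval.toSet]
    | finite r ε =>
      rw [hI] at h1 h2
      simp only [CodedInterval.toSet, CodedInterval.diam, Set.mem_Icc] at h1 h2 ⊢
      have h3 : (δ : ℝ) < 2 * ε := by exact_mod_cast (WithTop.coe_lt_coe.1 h2)
      by_cases h4 : x + δ / 2 ≤ r + ε
      · left; constructor <;> linarith
      · right; constructor <;> linarith
  have hall : (∀ n, x + δ / 2 ∈ (I n).toSet) ∨ (∀ n, x - δ / 2 ∈ (I n).toSet) := by
    by_contra! h
    obtain ⟨⟨n, hn⟩, m, hm⟩ := h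
    rcases hor (max n m) with h | h
    · exact hn (hanti (le_max_left n m) h)
    · exact hm (hanti (le_max_right n m) h)
  rcases hall with h | h
  · have := hx ▸ Set.mem_iInter.2 h
    simp at this; exact hδ.ne' this
  · have := hx ▸ Set.mem_iInter.2 h
    simp at this; exact hδ.ne' this

theorem intervalParam_mono (ψ : StringFun) (h : (intervalRep ψ).Dom) (n : ℕ) :
    intervalParam ψ n ≤ intervalParam ψ (n + 1) := by
  obtain ⟨x, I, hI, hnest, hx⟩ := h
  refine Nat.add_le_add_right (csInf_le_csInf ⟨0, fun _ _ => Nat.zero_le _⟩ ?_ ?_) _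
  · obtain ⟨N, hN⟩ := IsIntervalName.exists_diam_le hnest hx
      (by positivity : (0 : ℚ) < ((2 : ℚ) ^ (n + 1))⁻¹)
    exact ⟨N, I, hI, hN⟩
  · rintro N ⟨J, hJ, hN⟩
    refine ⟨J, hJ, hN.trans (WithTop.coe_le_coe.2 ?_)⟩
    gcongr
    · norm_num
    · omega

/-- The preparametrised space of interval reals. -/
noncomputable def intervalReals : PreparametrisedSpace ℝ where
  rep := intervalRep
  rep_surjective x := (exists_isIntervalName x).imp fun _ h => mem_intervalRep.2 h
  param := intervalParam
  param_mono := intervalParam_mono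

/-! A name may postpone its information: if every interval is replaced by an earlier one, with
indices growing monotonically to infinity, the result is a name of the same point, and the delay
shows only in the parameter. Hence a machine need not wait for the given machine `N`. On input `a`,
the clocked machine runs `N` on the codes of `1, 2, 4, …` in turn for `|a|` units of time and
outputs the result of the last complete run, or the empty string, which codes the infinite interval,
if there is none. This is linear time with every oracle, whether or not `N` halts with it
(`Clocked.exists_reaches_halt`).

Let `t i` be the time of the run on the code of `2 ^ i`, and `T k` the sum of `t i + 1` over `i <
k`. On inputs of length at least `T (N + 1)` the output interval lies in the `N`-th interval of the
original name (`Clocked.exists_delayed`), so an index `N` in the parameter becomes at most `T (N +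
1)` (`Clocked.intervalParam_le`). If `P` bounds the time of `N` and `Q` its parameter blowup, this
is at most `(Q + 1) * (P (Q + 2) + 1)`, again a second-order polynomial.

The difficulty is to start every run on clean tapes without losing linear time. Each simulated step
is recorded on a history tape, and the records are undone backwards (`Clocked.reaches_rewind`). The
exception is the answer tape: an oracle answer can be far longer than the time spent, so it can be
neither erased nor saved. The next call overwrites it anyway; until the first call of a run, a work
tape stands in for it. Finally, the simulated input is extended at its left end, where the head
stands after undoing, so passing to the next power of two takes a constant number of steps. -/

/-! ### Preliminaries on oracle machines -/

instance : Finite Letter :=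
  Finite.of_surjective (fun o : Option Bool => o.elim Letter.sep Letter.ofBit) fun
    | .zero => ⟨some false, rfl⟩
    | .one => ⟨some true, rfl⟩
    | .sep => ⟨none, rfl⟩

instance : Finite HeadMove :=
  Finite.of_surjective
    (fun o : Option Bool => o.elim HeadMove.stay fun b => cond b HeadMove.right HeadMove.left) fun
    | .left => ⟨some false, rfl⟩
    | .stay => ⟨none, rfl⟩
    | .right => ⟨some true, rfl⟩

instance {W : Type} [Finite W] : Finite (TapeName W) :=
  Finite.of_surjective
    (fun o : (Bool × Bool) ⊕ W => o.elim
      (fun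
        | (false, false) => TapeName.input
        | (false, true) => TapeName.output
        | (true, false) => TapeName.query
        | (true, true) => TapeName.answer) TapeName.work) fun
    | .input => ⟨.inl (false, false), rfl⟩
    | .output => ⟨.inl (false, true), rfl⟩
    | .query => ⟨.inl (true, false), rfl⟩
    | .answer => ⟨.inl (true, true), rfl⟩
    | .work w => ⟨.inr w, rfl⟩

/-- The move in the opposite direction. -/
def HeadMove.inv : HeadMove → HeadMove
  | .left => .right
  | .stay => .stay
  | .right => .left

theorem HeadMove.toInt_inv (m : HeadMove) : m.inv.toInt = -m.toInt := by
  cases m <;> rfl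

theorem writtenTape_natCast {A : Type} (s : List Letter) (i : ℕ) :
    (writtenTape s i : TapeCell A) = (s[i]?).map Sum.inl := rfl

/-- The alphabets may differ, so a simulated tape can be compared with its encoding. -/
theorem tapeContent_congr {A B : Type} {T : ℤ → TapeCell A} {T' : ℤ → TapeCell B}
    (h : ∀ z, (T z).letter = (T' z).letter) : tapeContent T = tapeContent T' := by
  have e : ∀ n : ℕ, (T n).letter = (T' n).letter := fun n => h n
  by_cases hn : ∃ n : ℕ, (T n).letter = none
  · have hn' : ∃ n : ℕ, (T' n).letter = none := hn.imp fun n hn => e n ▸ hn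
    have : Nat.find hn = Nat.find hn' := Nat.find_congr' fun {n} => by rw [e n]
    rw [tapeContent, tapeContent, dif_pos hn, dif_pos hn', this]
    simp only [e]
  · have hn' : ¬ ∃ n : ℕ, (T' n).letter = none := fun hn' => hn (hn'.imp fun n hn => e n ▸ hn)
    rw [tapeContent, tapeContent, dif_neg hn, dif_neg hn']

theorem tapeContent_blank {A : Type} : tapeContent (fun _ => none : ℤ → TapeCell A) = [] := by
  have h : ∃ n : ℕ, TapeCell.letter ((fun _ => none : ℤ → TapeCell A) n) = none := ⟨0, rfl⟩
  rw [tapeContent, dif_pos h, (Nat.find_eq_zero h).2 rfl]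
  rfl

namespace OracleMachine

theorem step_of_halted {M : OracleMachine} {φ : StringFun} {c : M.Config}
    (h : c.state = M.halt) : M.step φ c = c := by
  simp [step, h]

theorem iterate_step_of_halted {M : OracleMachine} {φ : StringFun} {c : M.Config}
    (h : c.state = M.halt) (n : ℕ) : (M.step φ)^[n] c = c :=
  Function.iterate_fixed (step_of_halted h) n

theorem run_succ (M : OracleMachine) (φ : StringFun) (a : List Letter) (n : ℕ) :
    M.run φ a (n + 1) = M.step φ (M.run φ a n) :=
  Function.iterate_succ_apply' _ _ _

theorem run_eq_of_haltsAfter {M : OracleMachine} {φ : StringFun} {a : List Letter} {m n : ℕ}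
    (h : M.HaltsAfter φ a m) (hmn : m ≤ n) : M.run φ a n = M.run φ a m := by
  obtain ⟨d, rfl⟩ := Nat.exists_eq_add_of_le hmn
  rw [run, Nat.add_comm, Function.iterate_add_apply]
  exact iterate_step_of_halted h d

theorem run_eq_run_of_haltsAfter {M : OracleMachine} {φ : StringFun} {a : List Letter} {m n : ℕ}
    (hm : M.HaltsAfter φ a m) (hn : M.HaltsAfter φ a n) : M.run φ a n = M.run φ a m := by
  rcases le_total m n with h | h
  · exact run_eq_of_haltsAfter hm h
  · exact (run_eq_of_haltsAfter hn h).symm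

theorem time_le_of_haltsAfter {M : OracleMachine} {φ : StringFun} {a : List Letter} {n : ℕ}
    (h : M.HaltsAfter φ a n) : M.time φ a ≤ n :=
  iInf₂_le n h

theorem exists_haltsAfter_of_time_le {M : OracleMachine} {φ : StringFun} {a : List Letter} {p : ℕ}
    (h : M.time φ a ≤ p) : ∃ n ≤ p, M.HaltsAfter φ a n := by
  by_contra! hcon
  have : ((p + 1 : ℕ) : ℕ∞) ≤ M.time φ a := by
    refine le_iInf₂ fun n hn => ?_
    by_contra! hlt
    exact hcon n (by have := (Nat.cast_lt (α := ℕ∞)).1 hlt; omega) hn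
  have := (Nat.cast_le (α := ℕ∞)).1 (this.trans h)
  omega

/-- The machine halts after exactly `n` steps. -/
def HaltsAt (M : OracleMachine) (φ : StringFun) (a : List Letter) (n : ℕ) : Prop :=
  M.HaltsAfter φ a n ∧ ∀ m < n, ¬ M.HaltsAfter φ a m

theorem HaltsAfter.exists_haltsAt {M : OracleMachine} {φ : StringFun} {a : List Letter} {n : ℕ}
    (h : M.HaltsAfter φ a n) : ∃ t ≤ n, M.HaltsAt φ a t := by
  classical
  exact ⟨Nat.find ⟨n, h⟩, Nat.find_min' _ h, Nat.find_spec ⟨n, h⟩, fun _ hm => Nat.find_min _ hm⟩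

theorem HaltsAt.unique {M : OracleMachine} {φ : StringFun} {a : List Letter} {m n : ℕ}
    (hm : M.HaltsAt φ a m) (hn : M.HaltsAt φ a n) : m = n := by
  by_contra hne
  rcases lt_or_gt_of_ne hne with h | h
  · exact hn.2 m h hm.1
  · exact hm.2 n h hn.1

theorem mem_operator_iff {M : OracleMachine} {φ ψ : StringFun} :
    ψ ∈ M.operator φ ↔
      ∀ a, ∃ n, M.HaltsAfter φ a n ∧ tapeContent ((M.run φ a n).tape .output) = ψ a := by
  classical
  constructor
  · rintro ⟨h, rfl⟩ a
    exact ⟨_, Nat.find_spec (h a), rfl⟩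
  · intro h
    refine ⟨fun a => (h a).imp fun _ hn => hn.1, funext fun a => ?_⟩
    obtain ⟨n, hn, e⟩ := h a
    rw [← e]
    change tapeContent ((M.run φ a (Nat.find _)).tape .output) = _
    rw [run_eq_run_of_haltsAfter hn (Nat.find_spec (p := fun n => M.HaltsAfter φ a n) ⟨n, hn⟩)]

/-- The configuration `c'` is reached from `c` within `n` steps. -/
def ReachesIn (M : OracleMachine) (φ : StringFun) (n : ℕ) (c c' : M.Config) : Prop :=
  ∃ s ≤ n, (M.step φ)^[s] c = c'

theorem ReachesIn.refl {M : OracleMachine} {φ : StringFun} (c : M.Config) : M.ReachesIn φ 0 c c :=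
  ⟨0, le_rfl, rfl⟩

theorem ReachesIn.single {M : OracleMachine} {φ : StringFun} {c c' : M.Config}
    (h : M.step φ c = c') : M.ReachesIn φ 1 c c' :=
  ⟨1, le_rfl, h⟩

theorem ReachesIn.trans {M : OracleMachine} {φ : StringFun} {m n : ℕ} {c c' c'' : M.Config}
    (h : M.ReachesIn φ m c c') (h' : M.ReachesIn φ n c' c'') : M.ReachesIn φ (m + n) c c'' := by
  obtain ⟨s, hs, rfl⟩ := h
  obtain ⟨s', hs', rfl⟩ := h'
  exact ⟨s' + s, by omega, Function.iterate_add_apply _ _ _ _⟩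

theorem ReachesIn.mono {M : OracleMachine} {φ : StringFun} {m n : ℕ} {c c' : M.Config}
    (h : M.ReachesIn φ m c c') (hmn : m ≤ n) : M.ReachesIn φ n c c' :=
  h.imp fun _ hs => ⟨hs.1.trans hmn, hs.2⟩

end OracleMachine

/-! ### The clocked machine -/

namespace Clocked

/-- The record of a step of the simulated machine: the symbols that were scanned and the moves made;
or, for an oracle call, the mode of the simulation. -/
abbrev Record (N : OracleMachine) : Type :=
  ((TapeName N.Work → TapeCell N.Aux) × (TapeName N.Work → HeadMove)) ⊕ Bool

/-- The states of the clocked machine. In `sim final post q` the simulated machine is in the state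
`q`; `final` says that the simulation is not timed, `post` that an oracle call has been made. -/
inductive State (Q : Type)
  | sim (final post : Bool) (q : Q)
  | ask
  | resume
  | seek (success : Bool)
  | restore (success : Bool)
  | grow₁
  | grow₂
  | grow₃
  | shrink₁
  | shrink₂
  | halt

instance {Q : Type} [Finite Q] : Finite (State Q) := by
  let F : State Q → (Bool × Bool × Q) ⊕ Bool ⊕ Bool ⊕ Fin 8 := fun
    | .sim f p q => .inl (f, p, q)
    | .seek b => .inr (.inl b)
    | .restore b => .inr (.inr (.inl b))
    | .ask => .inr (.inr (.inr 0))
    | .resume => .inr (.inr (.inr 1))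
    | .grow₁ => .inr (.inr (.inr 2))
    | .grow₂ => .inr (.inr (.inr 3))
    | .grow₃ => .inr (.inr (.inr 4))
    | .shrink₁ => .inr (.inr (.inr 5))
    | .shrink₂ => .inr (.inr (.inr 6))
    | .halt => .inr (.inr (.inr 7))
  refine Finite.of_injective F fun x y h => ?_
  cases x <;> cases y <;> simp [F] at h ⊢ <;> simp [h]

/-- Change a family indexed by the tapes at the input tape. -/
def onInput {W X : Type} (x : X) (g : TapeName W → X) : TapeName W → X
  | .input => x
  | t => g t

/-- Change a family indexed by the tapes at the answer tape. -/
def onAnswer {W X : Type} (x : X) (g : TapeName W → X) : TapeName W → X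
  | .answer => x
  | t => g t

/-- The work tapes of the clocked machine in addition to those of the simulated machine. -/
inductive Extra
  | input
  | answer
  | history

instance : Finite Extra :=
  Finite.of_surjective (fun o : Option Bool => o.elim Extra.input fun b =>
    cond b Extra.answer Extra.history) fun
    | .input => ⟨none, rfl⟩
    | .answer => ⟨some true, rfl⟩
    | .history => ⟨some false, rfl⟩

/-- The tape of the clocked machine that plays the role of a tape of the simulated machine. The
answer tape is represented by a work tape until the first oracle call. -/
def phys {W : Type} : TapeName W → TapeName (W ⊕ Extra)
  | .input => .work (.inr .input)
  | .output => .output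
  | .query => .query
  | .answer => .work (.inr .answer)
  | .work w => .work (.inl w)

/-- A family indexed by the tapes of the clocked machine, given by its values at the input tape (which
is the clock), the answer tape, the history tape, and the tapes of the simulated machine. -/
def combine {W X : Type} (clock answer history : X) (g : TapeName W → X) :
    TapeName (W ⊕ Extra) → X
  | .input => clock
  | .output => g .output
  | .query => g .query
  | .answer => answer
  | .work (.inl w) => g (.work w)
  | .work (.inr .input) => g .input
  | .work (.inr .answer) => g .answer
  | .work (.inr .history) => history

theorem combine_phys {W X : Type} (x y z : X) (g : TapeName W → X) (t : TapeName W) :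
    combine x y z g (phys t) = g t := by
  cases t <;> rfl

/-- Symbols of the simulated machine as symbols of the clocked machine. -/
def enc {A R : Type} : TapeCell A → TapeCell (A ⊕ R)
  | none => none
  | some (.inl s) => some (.inl s)
  | some (.inr x) => some (.inr (.inl x))

def dec {A R : Type} : TapeCell (A ⊕ R) → TapeCell A
  | some (.inl s) => some (.inl s)
  | some (.inr (.inl x)) => some (.inr x)
  | _ => none

/-- Records as symbols of the clocked machine. -/
def encRecord {A R : Type} (r : R) : TapeCell (A ⊕ R) := some (.inr (.inr r))

def decRecord {A R : Type} : TapeCell (A ⊕ R) → Option R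
  | some (.inr (.inr r)) => some r
  | _ => none

@[simp] theorem dec_enc {A R : Type} (x : TapeCell A) : dec (enc x : TapeCell (A ⊕ R)) = x := by
  rcases x with _ | _ | _ <;> rfl

@[simp] theorem decRecord_encRecord {A R : Type} (r : R) :
    decRecord (encRecord r : TapeCell (A ⊕ R)) = some r := rfl

theorem letter_enc {A R : Type} (x : TapeCell A) :
    (enc x : TapeCell (A ⊕ R)).letter = x.letter := by
  rcases x with _ | _ | _ <;> rfl

theorem enc_writtenTape {A R : Type} (s : List Letter) (z : ℤ) :
    (enc (writtenTape s z) : TapeCell (A ⊕ R)) = writtenTape s z := by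
  cases z with
  | ofNat i =>
    change enc ((s[i]?).map Sum.inl) = (s[i]?).map Sum.inl
    cases s[i]? <;> rfl
  | negSucc => rfl

/-- What the clocked machine does in one step: the new state, the move on the clock, the symbol
written on the answer tape (whose head moves with that of the tape representing it), the record
written on the history tape, if any, the move there, and the actions on the other tapes. -/
structure Action (N : OracleMachine) where
  state : State N.State
  tick : HeadMove
  answer : TapeCell N.Aux
  write : Option (Record N)
  move : HeadMove
  tapes : TapeName N.Work → TapeCell N.Aux × HeadMove

open Classical in
/-- The actions of the clocked machine for `N`, depending on the state, on whether the clock has run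
down, and on the symbols scanned on the answer tape, the history tape, and the other tapes. -/
noncomputable def action (N : OracleMachine) : State N.State → Bool → TapeCell N.Aux →
    Option (Record N) → (TapeName N.Work → TapeCell N.Aux) → Action N
  | .sim final post q, expired, x, _, s =>
    if final = false ∧ expired = true then
      ⟨.seek false, .stay, x, none, .left, fun t => (s t, .stay)⟩
    else if q = N.halt then
      ⟨if final then .halt else .seek true, .right, x, none, .left, fun t => (s t, .stay)⟩
    else if q = N.ask then
      ⟨.ask, .right, x, some (.inr final), .stay, fun t => (s t, .stay)⟩
    else
      let r := N.trans q (if post then onAnswer x s else s)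
      ⟨.sim final post r.1, .right, if post then (r.2 .answer).1 else x,
        some (.inl (s, fun t => (r.2 t).2)), .right,
        fun t => (if post then onAnswer (s .answer) (fun t => (r.2 t).1) t else (r.2 t).1,
          (r.2 t).2)⟩
  | .resume, _, x, some (.inr final), s =>
    ⟨.sim final true N.resume, .stay, x, none, .right, fun t => (s t, .stay)⟩
  | .seek success, _, x, some (.inl r), s =>
    ⟨.restore success, .stay, x, none, .stay, fun t => (s t, (r.2 t).inv)⟩
  | .seek success, _, x, some (.inr _), s =>
    ⟨.restore success, .stay, x, none, .stay, fun t => (s t, .stay)⟩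
  | .seek true, _, x, none, s =>
    ⟨.grow₁, .stay, x, none, .right, onInput (s .input, .right) fun t => (s t, .stay)⟩
  | .seek false, _, x, none, s =>
    ⟨.shrink₁, .stay, x, none, .right, onInput (none, .right) fun t => (s t, .stay)⟩
  | .restore success, _, x, some (.inl r), _ =>
    ⟨.seek success, .stay, x, none, .left, fun t => (r.1 t, .stay)⟩
  | .restore success, _, x, _, s =>
    ⟨.seek success, .stay, x, none, .left, fun t => (s t, .stay)⟩
  | .grow₁, _, x, _, s =>
    ⟨.grow₂, .stay, x, none, .stay,
      onInput (some (.inl .zero), .left) fun t => (s t, .stay)⟩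
  | .grow₂, _, x, _, s =>
    ⟨.grow₃, .stay, x, none, .stay,
      onInput (some (.inl .one), .left) fun t => (s t, .stay)⟩
  | .grow₃, _, x, _, s =>
    ⟨.sim false false N.start, .stay, x, none, .stay,
      onInput (some (.inl .zero), .stay) fun t => (s t, .stay)⟩
  | .shrink₁, _, x, _, s =>
    ⟨.shrink₂, .stay, x, none, .stay,
      onInput (some (.inl .zero), .right) fun t => (s t, .stay)⟩
  | .shrink₂, _, x, _, s =>
    if s .input = none then ⟨.halt, .stay, x, none, .stay, fun t => (s t, .stay)⟩
    else ⟨.sim true false N.start, .stay, x, none, .stay,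
      onInput (some (.inl .one), .left) fun t => (s t, .stay)⟩
  | _, _, x, _, s => ⟨.halt, .stay, x, none, .stay, fun t => (s t, .stay)⟩

/-- The transition function of the clocked machine. -/
noncomputable def transition (N : OracleMachine) (q : State N.State)
    (s : TapeName (N.Work ⊕ Extra) → TapeCell (N.Aux ⊕ Record N)) :
    State N.State × (TapeName (N.Work ⊕ Extra) → TapeCell (N.Aux ⊕ Record N) × HeadMove) :=
  let r := action N q (s .input).isNone (dec (s .answer))
    (decRecord (s (.work (.inr .history)))) (fun t => dec (s (phys t)))
  (r.state, combine (s .input, r.tick) (enc r.answer, (r.tapes .answer).2)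
    (r.write.elim (s (.work (.inr .history))) encRecord, r.move)
    fun t => (enc (r.tapes t).1, (r.tapes t).2))

theorem isNone_enc {A R : Type} (x : TapeCell A) :
    (enc x : TapeCell (A ⊕ R)).isNone = x.isNone := by
  rcases x with _ | _ | _ <;> rfl

theorem transition_combine {N : OracleMachine} {q : State N.State} {x y : TapeCell N.Aux}
    {z : TapeCell (N.Aux ⊕ Record N)} {g : TapeName N.Work → TapeCell N.Aux} {r : Action N}
    (hr : action N q x.isNone y (decRecord z) g = r) :
    transition N q (combine (enc x) (enc y) z fun t => enc (g t)) =
      (r.state, combine (enc x, r.tick) (enc r.answer, (r.tapes .answer).2)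
        (r.write.elim z encRecord, r.move) fun t => (enc (r.tapes t).1, (r.tapes t).2)) := by
  subst hr
  simp only [transition, combine_phys, dec_enc]
  simp only [combine, dec_enc, isNone_enc]

/-- The clocked machine for `N`: it runs `N` on the codes of `1, 2, 4, …` as long as the clock, the
length of the input, permits, undoing each run by means of the history tape, and finally repeats the
last complete run. -/
noncomputable def machine (N : OracleMachine) : OracleMachine where
  State := State N.State
  Aux := N.Aux ⊕ Record N
  Work := N.Work ⊕ Extra
  finite_state := have := N.finite_state; inferInstance
  finite_aux := have := N.finite_aux; have := N.finite_work; inferInstance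
  finite_work := have := N.finite_work; inferInstance
  start := .grow₂
  ask := .ask
  resume := .resume
  halt := .halt
  trans := transition N

/-- A configuration of the clocked machine. -/
def config (N : OracleMachine) (a : List Letter) (q : State N.State) (i : ℤ)
    (answer : ℤ → TapeCell N.Aux) (history : ℤ → TapeCell (N.Aux ⊕ Record N)) (h : ℤ)
    (tape : TapeName N.Work → ℤ → TapeCell N.Aux) (head : TapeName N.Work → ℤ) :
    (machine N).Config where
  state := q
  tape := combine (writtenTape a) (fun z => enc (answer z)) history fun t z => enc (tape t z)
  head := combine i (head .answer) h head

theorem enc_update {A R : Type} (T : ℤ → TapeCell A) (z : ℤ) (x : TapeCell A) :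
    (fun y => (enc (Function.update T z x y) : TapeCell (A ⊕ R))) =
      Function.update (fun y => enc (T y)) z (enc x) := by
  funext y
  by_cases h : y = z
  · subst h; simp
  · simp [h]

/-- Later steps other than oracle calls are computed from `action` alone, without unfolding the
clocked machine. -/
theorem step_config {N : OracleMachine} {φ : StringFun} {a : List Letter} {q : State N.State}
    {i : ℤ} {answer : ℤ → TapeCell N.Aux} {history : ℤ → TapeCell (N.Aux ⊕ Record N)} {h : ℤ}
    {tape : TapeName N.Work → ℤ → TapeCell N.Aux} {head : TapeName N.Work → ℤ} {r : Action N}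
    (hhalt : q ≠ .halt) (hask : q ≠ .ask)
    (hr : action N q (writtenTape a i : TapeCell N.Aux).isNone (answer (head .answer))
      (decRecord (history h)) (fun t => tape t (head t)) = r) :
    (machine N).step φ (config N a q i answer history h tape head) =
      config N a r.state (i + r.tick.toInt) (Function.update answer (head .answer) r.answer)
        (r.write.elim history fun x => Function.update history h (encRecord x)) (h + r.move.toInt)
        (fun t => Function.update (tape t) (head t) (r.tapes t).1)
        (fun t => head t + (r.tapes t).2.toInt) := by
  have hh : ¬ (config N a q i answer history h tape head).state = (machine N).halt := hhalt
  have ha : ¬ (config N a q i answer history h tape head).state = (machine N).ask := hask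
  rw [OracleMachine.step, if_neg hh, if_neg ha]
  have key : (machine N).trans (config N a q i answer history h tape head).state
      (fun t => (config N a q i answer history h tape head).tape t
        ((config N a q i answer history h tape head).head t)) =
      (r.state, combine (enc (writtenTape a i), r.tick) (enc r.answer, (r.tapes .answer).2)
        (r.write.elim (history h) encRecord, r.move)
        fun t => (enc (r.tapes t).1, (r.tapes t).2)) := by
    rw [← transition_combine hr]
    have e : (fun t : TapeName (N.Work ⊕ Extra) =>
        ((config N a q i answer history h tape head).tape t
          ((config N a q i answer history h tape head).head t) : TapeCell (N.Aux ⊕ Record N))) =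
        combine (enc (writtenTape a i)) (enc (answer (head .answer))) (history h)
          fun t => enc (tape t (head t)) := by
      funext t
      rcases t with _ | _ | _ | _ | _ | _ | _ | _
      · exact (enc_writtenTape _ _).symm
      all_goals rfl
    exact congrArg (transition N q) e
  simp only [key]
  refine OracleMachine.Config.mk.injEq .. |>.mpr ⟨rfl, funext fun t => ?_, funext fun t => ?_⟩
  · rcases t with _ | _ | _ | _ | _ | _ | _ | _
    · exact (congrArg _ (enc_writtenTape _ _)).trans (Function.update_eq_self _ _)
    · exact (enc_update _ _ _).symm
    · exact (enc_update _ _ _).symm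
    · exact (enc_update _ _ _).symm
    · exact (enc_update _ _ _).symm
    · exact (enc_update _ _ _).symm
    · exact (enc_update _ _ _).symm
    · change Function.update history h (r.write.elim (history h) encRecord) = _
      cases r.write
      · exact Function.update_eq_self _ _
      · rfl
  · rcases t with _ | _ | _ | _ | _ | _ | _ | _ <;> rfl

open OracleMachine

/-! ### Representation of simulated configurations and of the history -/

/-- The code of `2 ^ k`. -/
def powCode (k : ℕ) : List Letter := Letter.zero :: Letter.one :: List.replicate k Letter.zero

/-- In the run on `powCode k`, the cell `z` of the tape representing the tape `t` of the simulated
machine represents the cell `z + offset k t`. -/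
def offset {W : Type} (k : ℕ) : TapeName W → ℤ := onInput (k + 1 : ℤ) fun _ => 0

/-- The code ends at cell `0` and extends to the left, so the tapes for `k` and `k + 1` differ only
in three cells at the left end. -/
def codeTape {A : Type} (k : ℕ) (z : ℤ) : TapeCell A := writtenTape (powCode k) (z + (k + 1))

/-- The representation of the tapes at the start of the run on `powCode k`. -/
def startTape {W A : Type} (k : ℕ) : TapeName W → ℤ → TapeCell A :=
  onInput (codeTape k) fun _ _ => none

def startHead {W : Type} (k : ℕ) : TapeName W → ℤ := onInput (-(k + 1 : ℤ)) fun _ => 0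

theorem codeTape_apply {A : Type} (k : ℕ) (z : ℤ) :
    (codeTape k z : TapeCell A) =
      if z = -(k + 1 : ℤ) then some (.inl .zero)
      else if z = -(k : ℤ) then some (.inl .one)
      else if -(k : ℤ) < z ∧ z ≤ 0 then some (.inl .zero) else none := by
  unfold codeTape
  obtain ⟨w, rfl⟩ : ∃ w : ℤ, z = w - (k + 1) := ⟨z + (k + 1), by ring⟩
  rw [sub_add_cancel]
  rcases w with (_ | _ | i) | i
  · rw [if_pos (by simp)]; rfl
  · rw [if_neg (by simp), if_pos (by simp)]; rfl
  · rw [if_neg (by simp; omega), if_neg (by simp; omega)]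
    change ((powCode k)[i + 2]?).map Sum.inl = _
    simp only [powCode, List.getElem?_cons_succ, List.getElem?_replicate]
    by_cases h : i < k
    · rw [if_pos h, if_pos (by simp; omega)]; rfl
    · rw [if_neg h, if_neg (by simp; omega)]; rfl
  · rw [if_neg (by omega), if_neg (by omega), if_neg (by omega)]; rfl

theorem codeTape_grow {A : Type} (k : ℕ) :
    Function.update (Function.update (Function.update (codeTape k : ℤ → TapeCell A)
      (-(k : ℤ)) (some (.inl .zero))) (-(k + 1 : ℤ)) (some (.inl .one)))
      (-(k + 2 : ℤ)) (some (.inl .zero)) = codeTape (k + 1) := by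
  funext z
  simp only [Function.update_apply, codeTape_apply]
  push_cast
  split_ifs <;> first | rfl | omega

theorem codeTape_shrink {A : Type} (k : ℕ) :
    Function.update (Function.update (Function.update (codeTape (k + 1) : ℤ → TapeCell A)
      (-(k + 2 : ℤ)) none) (-(k + 1 : ℤ)) (some (.inl .zero)))
      (-(k : ℤ)) (some (.inl .one)) = codeTape k := by
  funext z
  simp only [Function.update_apply, codeTape_apply]
  push_cast
  split_ifs <;> first | rfl | omega

/-- The last two writes of the growing phase, made on blank tape, produce the code of `1`; this is
why the machine starts in `grow₂`. -/
theorem codeTape_boot {A : Type} :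
    Function.update (Function.update (fun _ => none : ℤ → TapeCell A) 0 (some (.inl .one)))
      (-1) (some (.inl .zero)) = codeTape 0 := by
  funext z
  simp only [Function.update_apply, codeTape_apply]
  push_cast
  split_ifs <;> first | rfl | omega

/-- The history tape holds the records `l`, the first of which is the topmost. -/
def HistoryHolds {A R : Type} (H : ℤ → TapeCell (A ⊕ R)) : List R → Prop
  | [] => H (-1) = none
  | r :: l => H l.length = encRecord r ∧ HistoryHolds H l

theorem HistoryHolds.update {A R : Type} {H : ℤ → TapeCell (A ⊕ R)} {l : List R}
    (h : HistoryHolds H l) {n : ℕ} (hn : l.length ≤ n) (x : TapeCell (A ⊕ R)) :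
    HistoryHolds (Function.update H n x) l := by
  induction l with
  | nil =>
    change Function.update H n x (-1) = none
    rw [Function.update_of_ne (by omega)]
    exact h
  | cons r l ih =>
    rw [List.length_cons] at hn
    refine ⟨?_, ih h.2 (by omega)⟩
    rw [Function.update_of_ne (by omega)]
    exact h.1

theorem HistoryHolds.push {A R : Type} {H : ℤ → TapeCell (A ⊕ R)} {l : List R}
    (h : HistoryHolds H l) (r : R) :
    HistoryHolds (Function.update H l.length (encRecord r)) (r :: l) :=
  ⟨Function.update_self .., h.update le_rfl _⟩

/-- Undoing the recorded steps leads back to the start of the run on `powCode k`. -/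
def Undoes {N : OracleMachine} (k : ℕ) : List (Record N) →
    (TapeName N.Work → ℤ → TapeCell N.Aux) → (TapeName N.Work → ℤ) → Prop
  | [], tape, head => tape = startTape k ∧ head = startHead k
  | .inl r :: l, tape, head =>
    Undoes k l (fun t => Function.update (tape t) (head t + (r.2 t).inv.toInt) (r.1 t))
      (fun t => head t + (r.2 t).inv.toInt)
  | .inr _ :: l, tape, head => Undoes k l tape head

/-- The tapes of the simulated machine; `post` says that an oracle call has been made. -/
def view {W A : Type} (post : Bool) (answer : ℤ → TapeCell A) (tape : TapeName W → ℤ → TapeCell A) :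
    TapeName W → ℤ → TapeCell A :=
  if post then onAnswer answer tape else tape

structure Represents {N : OracleMachine} (k : ℕ) (c : N.Config) (post : Bool)
    (answer : ℤ → TapeCell N.Aux) (tape : TapeName N.Work → ℤ → TapeCell N.Aux)
    (head : TapeName N.Work → ℤ) : Prop where
  tape_eq : ∀ t z, view post answer tape t z = c.tape t (z + offset k t)
  head_eq : ∀ t, head t + offset k t = c.head t

/-- `C` is a configuration of the clocked machine, with the clock at `i`, in a run of the simulated
machine on `powCode k` that has reached the configuration `c` after `n` steps. -/
def Simulating {N : OracleMachine} (a : List Letter) (final : Bool) (k : ℕ) (i : ℤ) (n : ℕ)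
    (c : N.Config) (C : (machine N).Config) : Prop :=
  ∃ post answer H l tape head, l.length = n ∧ Represents k c post answer tape head ∧
    HistoryHolds H l ∧ Undoes k l tape head ∧
    C = config N a (.sim final post c.state) i answer H n tape head

/-! ### Single steps and the simulation of a run -/

variable {N : OracleMachine} {φ : StringFun} {a : List Letter}

theorem step_hold {q q' : State N.State} {i : ℤ} {answer : ℤ → TapeCell N.Aux}
    {H : ℤ → TapeCell (N.Aux ⊕ Record N)} {h : ℤ} {tape : TapeName N.Work → ℤ → TapeCell N.Aux}
    {head : TapeName N.Work → ℤ} {tick move : HeadMove} (hhalt : q ≠ .halt) (hask : q ≠ .ask)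
    (hr : action N q (writtenTape a i : TapeCell N.Aux).isNone (answer (head .answer))
      (decRecord (H h)) (fun t => tape t (head t)) =
      ⟨q', tick, answer (head .answer), none, move, fun t => (tape t (head t), .stay)⟩) :
    (machine N).step φ (config N a q i answer H h tape head) =
      config N a q' (i + tick.toInt) answer H (h + move.toInt) tape head := by
  rw [step_config hhalt hask hr]
  simp [HeadMove.toInt]

theorem step_onInput {q q' : State N.State} {i : ℤ} {answer : ℤ → TapeCell N.Aux}
    {H : ℤ → TapeCell (N.Aux ⊕ Record N)} {h : ℤ} {T : ℤ → TapeCell N.Aux} {p : ℤ}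
    {tape : TapeName N.Work → ℤ → TapeCell N.Aux} {head : TapeName N.Work → ℤ} {y : TapeCell N.Aux}
    {m move : HeadMove} (hhalt : q ≠ .halt) (hask : q ≠ .ask)
    (hr : action N q (writtenTape a i : TapeCell N.Aux).isNone (answer (head .answer))
      (decRecord (H h)) (fun t => onInput T tape t (onInput p head t)) =
      ⟨q', .stay, answer (head .answer), none, move,
        onInput (y, m) fun t => (onInput T tape t (onInput p head t), .stay)⟩) :
    (machine N).step φ (config N a q i answer H h (onInput T tape) (onInput p head)) =
      config N a q' i answer H (h + move.toInt) (onInput (Function.update T p y) tape)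
        (onInput (p + m.toInt) head) := by
  rw [step_config hhalt hask hr]
  have e1 : (fun t => Function.update (onInput T tape t) (onInput p head t)
      ((onInput (y, m) fun t => (onInput T tape t (onInput p head t), HeadMove.stay)) t).1) =
      onInput (Function.update T p y) tape := by
    funext t
    cases t <;> simp [onInput]
  have e2 : (fun t => onInput p head t +
      ((onInput (y, m) fun t => (onInput T tape t (onInput p head t), HeadMove.stay)) t).2.toInt) =
      onInput (p + m.toInt) head := by
    funext t
    cases t <;> simp [onInput, HeadMove.toInt]
  simp only [e1, e2]
  simp [HeadMove.toInt, onInput]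

theorem step_ask {i : ℤ} {answer : ℤ → TapeCell N.Aux} {H : ℤ → TapeCell (N.Aux ⊕ Record N)} {h : ℤ}
    {tape : TapeName N.Work → ℤ → TapeCell N.Aux} {head : TapeName N.Work → ℤ} :
    (machine N).step φ (config N a .ask i answer H h tape head) =
      config N a .resume i (writtenTape (φ (tapeContent (tape .query)))) H h tape head := by
  have hh : ¬ (config N a .ask i answer H h tape head).state = (machine N).halt := by
    change ¬ (State.ask = State.halt); simp
  have ha : (config N a .ask i answer H h tape head).state = (machine N).ask := rfl
  rw [OracleMachine.step, if_neg hh, if_pos ha]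
  refine OracleMachine.Config.mk.injEq .. |>.mpr ⟨rfl, funext fun t => ?_, rfl⟩
  rcases t with _ | _ | _ | _ | _ | _ | _ | _
  case answer =>
    change writtenTape (φ (tapeContent fun z => enc (tape .query z))) = fun z => enc (writtenTape _ z)
    simp only [enc_writtenTape]
    rw [tapeContent_congr fun z => letter_enc (tape .query z)]
  all_goals rfl

/-- An oracle call costs three steps: entering the oracle state, calling, and returning. Any other
step is simulated in one. In both cases the clock ticks once and one record is pushed. -/
theorem Simulating.step {final : Bool} {k : ℕ} {i : ℤ} {n : ℕ} {c : N.Config}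
    {C : (machine N).Config} (h : Simulating a final k i n c C) (hc : c.state ≠ N.halt)
    (hclock : final = true ∨ (writtenTape a i : TapeCell N.Aux).isNone = false) :
    ∃ C', Simulating a final k (i + 1) (n + 1) (N.step φ c) C' ∧ (machine N).ReachesIn φ 3 C C' := by
  obtain ⟨post, answer, H, l, tape, head, rfl, hrep, hH, hu, rfl⟩ := h
  have hclock' : ¬ (final = false ∧ (writtenTape a i : TapeCell N.Aux).isNone = true) := by
    rcases hclock with h | h <;> simp [h]
  by_cases hask : c.state = N.ask
  · let answer' : ℤ → TapeCell N.Aux := writtenTape (φ (tapeContent (tape .query)))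
    have hq : tapeContent (tape .query) = tapeContent (c.tape .query) := by
      refine tapeContent_congr fun z => ?_
      have := hrep.tape_eq .query z
      simp only [offset, onInput, add_zero] at this
      rw [← this, view]
      split <;> rfl
    have hstep : N.step φ c = ⟨N.resume, fun
        | .answer => writtenTape (φ (tapeContent (c.tape .query)))
        | t => c.tape t, c.head⟩ := (if_neg hc).trans (if_pos hask)
    refine ⟨config N a (.sim final true N.resume) (i + 1) answer'
        (Function.update H l.length (encRecord (.inr final))) (l.length + 1 : ℕ) tape head,
      ⟨true, _, _, .inr final :: l, tape, head, rfl, ⟨fun t z => ?_, fun t => ?_⟩, hH.push _, hu,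
        by rw [hstep]⟩, ?_⟩
    · rw [hstep]
      have := hrep.tape_eq t z
      cases t
      case answer => simp [view, onAnswer, offset, onInput, answer', hq]
      all_goals
        rw [← this]
        cases post <;> rfl
    · rw [hstep]
      exact hrep.head_eq t
    · have e1 : (machine N).step φ
          (config N a (.sim final post c.state) i answer H l.length tape head) =
          config N a .ask (i + 1) answer (Function.update H l.length (encRecord (.inr final)))
            l.length tape head := by
        rw [step_config (by simp) (by simp)
          (show _ = Action.mk .ask .right (answer (head .answer)) (some (.inr final)) .stay
            (fun t => (tape t (head t), .stay)) by
              rw [action, if_neg hclock', if_neg hc, if_pos hask])]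
        simp [HeadMove.toInt]
      -- The oracle states carry no data; `final` is read back from the record just written, on
      -- which the history head has stayed.
      have e3 : (machine N).step φ (config N a .resume (i + 1) answer'
            (Function.update H l.length (encRecord (.inr final))) l.length tape head) =
          config N a (.sim final true N.resume) (i + 1) answer'
            (Function.update H l.length (encRecord (.inr final))) (l.length + 1 : ℕ) tape head := by
        rw [step_hold (q' := .sim final true N.resume) (tick := .stay) (move := .right) (by simp)
          (by simp) (by rw [Function.update_self, decRecord_encRecord]; rfl)]
        simp [HeadMove.toInt]
      exact ((ReachesIn.single e1).trans (ReachesIn.single step_ask)).trans (ReachesIn.single e3)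
  · let s : TapeName N.Work → TapeCell N.Aux := fun t => tape t (head t)
    let r := N.trans c.state fun t => c.tape t (c.head t)
    have hs : (if post then onAnswer (answer (head .answer)) s else s) =
        fun t => c.tape t (c.head t) := by
      funext t
      rw [← hrep.head_eq t, ← hrep.tape_eq t]
      cases post
      · rfl
      · cases t <;> rfl
    have hstep : N.step φ c = ⟨r.1, fun t => Function.update (c.tape t) (c.head t) (r.2 t).1,
        fun t => c.head t + (r.2 t).2.toInt⟩ := by
      rw [OracleMachine.step, if_neg hc, if_neg hask]
    -- After a call the work tape standing for the answer tape keeps its content; only its head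
    -- moves, together with that of the real answer tape.
    let w : TapeName N.Work → TapeCell N.Aux :=
      if post then onAnswer (s .answer) (fun t => (r.2 t).1) else fun t => (r.2 t).1
    let x : TapeCell N.Aux := if post then (r.2 .answer).1 else answer (head .answer)
    have hact : action N (.sim final post c.state) (writtenTape a i : TapeCell N.Aux).isNone
        (answer (head .answer)) (decRecord (H l.length)) s =
        ⟨.sim final post r.1, .right, x, some (.inl (s, fun t => (r.2 t).2)), .right,
          fun t => (w t, (r.2 t).2)⟩ := by
      rw [action, if_neg hclock', if_neg hc, if_neg hask]
      simp only [hs]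
      cases post <;> rfl
    have hrun := step_config (φ := φ) (by simp) (by simp) hact
    refine ⟨_, ⟨post, Function.update answer (head .answer) x, _,
        .inl (s, fun t => (r.2 t).2) :: l, fun t => Function.update (tape t) (head t) (w t),
        fun t => head t + (r.2 t).2.toInt, rfl, ⟨fun t z => ?_, fun t => ?_⟩,
        hH.push _, ?_, rfl⟩, ReachesIn.mono (ReachesIn.single ?_) (by norm_num : 1 ≤ 3)⟩
    rotate_left 3
    · rw [hrun, hstep]
      simp only [HeadMove.toInt, Option.elim_some]
      rfl
    · rw [hstep]
      have h1 := hrep.tape_eq t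
      have h2 := hrep.head_eq t
      have key : view post (Function.update answer (head .answer) x)
          (fun t => Function.update (tape t) (head t) (w t)) t =
          Function.update (view post answer tape t) (head t) (r.2 t).1 := by
        cases post
        · rfl
        · cases t <;> rfl
      rw [key]
      simp only [Function.update_apply, ← h2, add_left_inj, h1]
    · rw [hstep]
      simp only [← hrep.head_eq t]
      ring
    -- Moving back and rewriting the scanned symbols cancels the step just made.
    · simp only [Undoes, HeadMove.toInt_inv, add_neg_cancel_right, Function.update_idem]
      have : (fun t => Function.update (tape t) (head t) (s t)) = tape := by
        funext t
        exact Function.update_eq_self _ _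
      rw [this]
      exact hu

theorem Simulating.run {final : Bool} {k : ℕ} {i : ℤ} {C : (machine N).Config}
    (h : Simulating a final k i 0 (N.init (powCode k)) C) (n : ℕ)
    (hn : ∀ m < n, ¬ N.HaltsAfter φ (powCode k) m)
    (hclock : final = true ∨ ∀ m < n, (writtenTape a (i + m) : TapeCell N.Aux).isNone = false) :
    ∃ C', Simulating a final k (i + n) n (N.run φ (powCode k) n) C' ∧
      (machine N).ReachesIn φ (3 * n) C C' := by
  induction n with
  | zero => exact ⟨C, by simpa [OracleMachine.run] using h, ReachesIn.refl C⟩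
  | succ n ih =>
    obtain ⟨C', hC', hr⟩ := ih (fun m hm => hn m (by omega))
      (hclock.imp_right fun h m hm => h m (by omega))
    obtain ⟨C'', hC'', hr'⟩ := hC'.step (φ := φ) (hn n (by omega))
      (hclock.imp_right fun h => h n (by omega))
    refine ⟨C'', ?_, (hr.trans hr').mono (by omega)⟩
    rw [run_succ]
    push_cast
    rwa [← add_assoc]

/-! ### Undoing runs and changing the simulated input -/

/-- Each record takes two steps, one moving the heads back and one restoring the symbols. For an
oracle call nothing needs undoing, because the call changed only the real answer tape, which
`Undoes` does not cover and which is never restored. -/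
theorem reaches_rewind {success : Bool} {k : ℕ} {i : ℤ} {answer : ℤ → TapeCell N.Aux}
    {H : ℤ → TapeCell (N.Aux ⊕ Record N)} {l : List (Record N)} (hH : HistoryHolds H l)
    {tape : TapeName N.Work → ℤ → TapeCell N.Aux} {head : TapeName N.Work → ℤ}
    (hu : Undoes k l tape head) :
    (machine N).ReachesIn φ (2 * l.length)
      (config N a (.seek success) i answer H (l.length - 1) tape head)
      (config N a (.seek success) i answer H (-1) (startTape k) (startHead k)) := by
  induction l generalizing tape head with
  | nil =>
    obtain ⟨rfl, rfl⟩ := hu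
    exact ReachesIn.refl _
  | cons r l ih =>
    have hl : ((r :: l).length : ℤ) - 1 = l.length := by simp
    have hd : decRecord (H l.length) = some r := by rw [hH.1, decRecord_encRecord]
    rw [hl]
    rcases r with r | m
    · have e1 : (machine N).step φ (config N a (.seek success) i answer H l.length tape head) =
          config N a (.restore success) i answer H l.length tape
            (fun t => head t + (r.2 t).inv.toInt) := by
        rw [step_config (by simp) (by simp)
          (show _ = Action.mk (.restore success) .stay (answer (head .answer)) none .stay
            (fun t => (tape t (head t), (r.2 t).inv)) by rw [hd]; cases success <;> rfl)]
        simp [HeadMove.toInt]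
      have e2 : (machine N).step φ (config N a (.restore success) i answer H l.length tape
            (fun t => head t + (r.2 t).inv.toInt)) =
          config N a (.seek success) i answer H (l.length - 1)
            (fun t => Function.update (tape t) (head t + (r.2 t).inv.toInt) (r.1 t))
            (fun t => head t + (r.2 t).inv.toInt) := by
        rw [step_config (by simp) (by simp)
          (show _ = Action.mk (.seek success) .stay
            (answer (head .answer + (r.2 .answer).inv.toInt)) none .left
            (fun t => (r.1 t, .stay)) by rw [hd]; rfl)]
        simp [HeadMove.toInt, sub_eq_add_neg]
      exact (((ReachesIn.single e1).trans (ReachesIn.single e2)).trans (ih hH.2 hu)).mono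
        (by simp; omega)
    · have e1 : (machine N).step φ (config N a (.seek success) i answer H l.length tape head) =
          config N a (.restore success) i answer H l.length tape head := by
        rw [step_hold (q' := .restore success) (tick := .stay) (move := .stay) (by simp)
          (by simp) (by rw [hd]; cases success <;> rfl)]
        simp [HeadMove.toInt]
      have e2 : (machine N).step φ (config N a (.restore success) i answer H l.length tape head) =
          config N a (.seek success) i answer H (l.length - 1) tape head := by
        rw [step_hold (q' := .seek success) (tick := .stay) (move := .left) (by simp)
          (by simp) (by rw [hd]; rfl)]
        simp [HeadMove.toInt, sub_eq_add_neg]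
      exact (((ReachesIn.single e1).trans (ReachesIn.single e2)).trans (ih hH.2 hu)).mono
        (by simp; omega)

/-- Debris of earlier runs is harmless: with `post = false` the real answer tape is not consulted,
and the empty history needs only its end mark in cell `-1`. -/
theorem simulating_start {final : Bool} {k : ℕ} {i : ℤ} {answer : ℤ → TapeCell N.Aux}
    {H : ℤ → TapeCell (N.Aux ⊕ Record N)} (hH : H (-1) = none) :
    Simulating a final k i 0 (N.init (powCode k))
      (config N a (.sim final false N.start) i answer H 0 (startTape k) (startHead k)) := by
  refine ⟨false, answer, H, [], _, _, rfl, ⟨fun t z => ?_, fun t => ?_⟩, hH, ⟨rfl, rfl⟩, rfl⟩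
  · cases t <;> rfl
  · cases t <;> simp [startHead, offset, onInput, OracleMachine.init]

/-- Undoing leaves the head on the sign letter, so lengthening the code takes the same number of
steps for all `k`. -/
theorem reaches_grow {k : ℕ} {i : ℤ} {answer : ℤ → TapeCell N.Aux}
    {H : ℤ → TapeCell (N.Aux ⊕ Record N)} (hH : H (-1) = none) :
    (machine N).ReachesIn φ 4
      (config N a (.seek true) i answer H (-1) (startTape k) (startHead k))
      (config N a (.sim false false N.start) i answer H 0 (startTape (k + 1))
        (startHead (k + 1))) := by
  rw [startTape, startHead]
  refine (((ReachesIn.single (step_onInput (q' := .grow₁) (move := .right)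
    (y := codeTape k (-(k + 1 : ℤ))) (m := .right) (by simp) (by simp) ?_)).trans
    (ReachesIn.single (step_onInput (q' := .grow₂) (move := .stay) (m := .left)
      (y := some (.inl .zero)) (by simp) (by simp) rfl))).trans
    (ReachesIn.single (step_onInput (q' := .grow₃) (move := .stay) (m := .left)
      (y := some (.inl .one)) (by simp) (by simp) rfl))).trans (ReachesIn.single ?_)
  · rw [hH]; rfl
  · rw [step_onInput (q' := .sim false false N.start) (move := .stay) (m := .stay)
      (y := some (.inl .zero)) (by simp) (by simp) rfl]
    rw [Function.update_eq_self, startTape, startHead, ← codeTape_grow]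
    simp only [HeadMove.toInt]
    congr 3
    · congr 2 <;> ring
    · ring
    · push_cast; ring

theorem HistoryHolds.bottom {A R : Type} {H : ℤ → TapeCell (A ⊕ R)} {l : List R}
    (h : HistoryHolds H l) : H (-1) = none := by
  induction l with
  | nil => exact h
  | cons r l ih => exact ih h.2

theorem isNone_writtenTape {A : Type} (a : List Letter) (i : ℕ) :
    (writtenTape a i : TapeCell A).isNone = decide (a.length ≤ i) := by
  rw [writtenTape_natCast, Option.isNone_map]
  by_cases h : a.length ≤ i <;> simp [h]; omega

theorem Simulating.reaches_of_expired {k : ℕ} {i : ℤ} {n : ℕ} {c : N.Config}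
    {C : (machine N).Config} (h : Simulating a false k i n c C)
    (hi : (writtenTape a i : TapeCell N.Aux).isNone = true) :
    ∃ answer H, H (-1) = none ∧ (machine N).ReachesIn φ (2 * n + 1) C
      (config N a (.seek false) i answer H (-1) (startTape k) (startHead k)) := by
  obtain ⟨post, answer, H, l, tape, head, rfl, -, hH, hu, rfl⟩ := h
  refine ⟨answer, H, hH.bottom, ?_⟩
  rw [Nat.add_comm]
  refine (ReachesIn.single ?_).trans (reaches_rewind hH hu)
  rw [step_hold (q' := .seek false) (tick := .stay) (move := .left) (by simp) (by simp)
    (by rw [action, if_pos ⟨rfl, hi⟩])]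
  simp [HeadMove.toInt, sub_eq_add_neg]

/-- Halting is charged one more tick, so the length of the input bounds the number of complete runs
even if `N` halts at once. -/
theorem Simulating.reaches_of_halted {k : ℕ} {i : ℤ} {n : ℕ} {c : N.Config}
    {C : (machine N).Config} (h : Simulating a false k i n c C) (hc : c.state = N.halt)
    (hi : (writtenTape a i : TapeCell N.Aux).isNone = false) :
    ∃ answer H, H (-1) = none ∧ (machine N).ReachesIn φ (2 * n + 1) C
      (config N a (.seek true) (i + 1) answer H (-1) (startTape k) (startHead k)) := by
  obtain ⟨post, answer, H, l, tape, head, rfl, -, hH, hu, rfl⟩ := h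
  refine ⟨answer, H, hH.bottom, ?_⟩
  rw [Nat.add_comm]
  refine (ReachesIn.single ?_).trans (reaches_rewind hH hu)
  rw [step_hold (q' := .seek true) (tick := .right) (move := .left) (by simp) (by simp)
    (by rw [action, if_neg (by simp [hi]), if_pos hc]; rfl)]
  simp [HeadMove.toInt, sub_eq_add_neg]

theorem Simulating.reaches_halt {k : ℕ} {i : ℤ} {n : ℕ} {c : N.Config}
    {C : (machine N).Config} (h : Simulating a true k i n c C) (hc : c.state = N.halt) :
    ∃ C', (machine N).ReachesIn φ 1 C C' ∧ C'.state = (machine N).halt ∧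
      tapeContent (C'.tape .output) = tapeContent (c.tape .output) := by
  obtain ⟨post, answer, H, l, tape, head, rfl, hrep, hH, hu, rfl⟩ := h
  refine ⟨_, ReachesIn.single (step_hold (q' := .halt) (tick := .right) (move := .left)
    (by simp) (by simp) (by rw [action, if_neg (by simp), if_pos hc]; rfl)), rfl, ?_⟩
  refine tapeContent_congr fun z => ?_
  have := hrep.tape_eq .output z
  simp only [offset, onInput, add_zero] at this
  rw [← this]
  cases post <;> exact letter_enc _

/-- When the run on `powCode (k + 1)` is cut off, the last complete run is that on `powCode k`. Its
output has been undone, so the run is repeated, this time untimed. -/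
theorem reaches_shrink {k : ℕ} {i : ℤ} {answer : ℤ → TapeCell N.Aux}
    {H : ℤ → TapeCell (N.Aux ⊕ Record N)} (hH : H (-1) = none) :
    (machine N).ReachesIn φ 3
      (config N a (.seek false) i answer H (-1) (startTape (k + 1)) (startHead (k + 1)))
      (config N a (.sim true false N.start) i answer H 0 (startTape k) (startHead k)) := by
  rw [startTape, startHead]
  refine ((ReachesIn.single (step_onInput (q' := .shrink₁) (move := .right)
    (y := none) (m := .right) (by simp) (by simp) ?_)).trans
    (ReachesIn.single (step_onInput (q' := .shrink₂) (move := .stay) (m := .right)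
      (y := some (.inl .zero)) (by simp) (by simp) rfl))).trans (ReachesIn.single ?_)
  · rw [hH]; rfl
  · rw [step_onInput (q' := .sim true false N.start) (move := .stay) (m := .left)
      (y := some (.inl .one)) (by simp) (by simp) ?_]
    · rw [startTape, startHead, ← codeTape_shrink k]
      simp only [HeadMove.toInt]
      congr 3
      · push_cast
        ring
      · push_cast; ring
    -- The third cell of `powCode (k + 1)` holds a zero; a blank there would mean that no run was
    -- completed.
    · rw [action, if_neg]
      · simp only [onInput, HeadMove.toInt, Function.update_apply, codeTape_apply]
        push_cast
        split_ifs <;> first | omega | simp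

/-- The code of `1` has only two letters, so `shrink₂` meets a blank and halts; the output tape has
been restored to blank. -/
theorem reaches_halt_of_none {i : ℤ} {answer : ℤ → TapeCell N.Aux}
    {H : ℤ → TapeCell (N.Aux ⊕ Record N)} (hH : H (-1) = none) :
    ∃ C, (machine N).ReachesIn φ 3
      (config N a (.seek false) i answer H (-1) (startTape 0) (startHead 0)) C ∧
      C.state = (machine N).halt ∧ tapeContent (C.tape .output) = [] := by
  rw [startTape, startHead]
  refine ⟨_, ((ReachesIn.single (step_onInput (q' := .shrink₁) (move := .right)
    (y := none) (m := .right) (by simp) (by simp) ?_)).trans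
    (ReachesIn.single (step_onInput (q' := .shrink₂) (move := .stay) (m := .right)
      (y := some (.inl .zero)) (by simp) (by simp) rfl))).trans
    (ReachesIn.single (step_hold (q' := .halt) (tick := .stay) (move := .stay)
      (by simp) (by simp) ?_)), rfl, tapeContent_blank⟩
  · rw [hH]; rfl
  · rw [action, if_pos]
    simp only [onInput, HeadMove.toInt, Function.update_apply, codeTape_apply]
    norm_num

theorem reaches_boot :
    ∃ answer H, H (-1) = none ∧ (machine N).ReachesIn φ 2 ((machine N).init a)
      (config N a (.sim false false N.start) 0 answer H 0 (startTape 0) (startHead 0)) := by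
  refine ⟨fun _ => none, fun _ => none, rfl, ?_⟩
  have e : (machine N).init a = config N a .grow₂ 0 (fun _ => none) (fun _ => none) 0
      (onInput (fun _ => none) fun _ _ => none) (onInput 0 fun _ => 0) := by
    refine OracleMachine.Config.mk.injEq .. |>.mpr ⟨rfl, funext fun t => ?_, funext fun t => ?_⟩ <;>
      rcases t with _ | _ | _ | _ | _ | _ | _ | _ <;> rfl
  rw [e]
  refine (ReachesIn.single (step_onInput (q' := .grow₃) (move := .stay) (m := .left)
      (y := some (.inl .one)) (by simp) (by simp) rfl)).trans (ReachesIn.single ?_)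
  rw [step_onInput (q' := .sim false false N.start) (move := .stay) (m := .stay)
    (y := some (.inl .zero)) (by simp) (by simp) rfl]
  rw [startTape, startHead, ← codeTape_boot]
  rfl

/-! ### Time accounting for the clocked machine -/

/-- The runs of `N` on the codes of `2 ^ j` with `j < k` halt and consume `n` units of time. -/
inductive Completed (N : OracleMachine) (φ : StringFun) : ℕ → ℕ → Prop
  | zero : Completed N φ 0 0
  | succ {k n t : ℕ} : Completed N φ k n → N.HaltsAt φ (powCode k) t →
      Completed N φ (k + 1) (n + t + 1)

theorem Completed.le {k n : ℕ} (h : Completed N φ k n) : k ≤ n := by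
  induction h with
  | zero => rfl
  | succ _ _ ih => omega

/-- The output after `k` complete runs. -/
def IsResult (N : OracleMachine) (φ : StringFun) : ℕ → List Letter → Prop
  | 0, s => s = []
  | k + 1, s => ∃ t, N.HaltsAfter φ (powCode k) t ∧
      tapeContent ((N.run φ (powCode k) t).tape .output) = s

/-- A run of `t` steps uses `t + 1` ticks and costs at most `3 * t` steps of simulation, `2 * t + 1`
of undoing and `4` of growing, within `10 * (t + 1)`. The initial `2` writes the first code. -/
theorem Completed.reaches {k n : ℕ} (h : Completed N φ k n) (hn : n ≤ a.length) :
    ∃ answer H, H (-1) = none ∧ (machine N).ReachesIn φ (10 * n + 2) ((machine N).init a)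
      (config N a (.sim false false N.start) n answer H 0 (startTape k) (startHead k)) := by
  induction h with
  | zero => exact reaches_boot
  | @succ k n t _ ht ih =>
    obtain ⟨answer, H, hH, hr⟩ := ih (by omega)
    have hclock : ∀ m ≤ t, (writtenTape a ((n : ℤ) + m) : TapeCell N.Aux).isNone = false := by
      intro m hm
      rw [← Nat.cast_add, isNone_writtenTape]
      simp
      omega
    obtain ⟨C₁, hC₁, hr₁⟩ := (simulating_start (a := a) (final := false) (k := k) (i := n)
      (answer := answer) hH).run (φ := φ) t ht.2 (.inr fun m hm => hclock m hm.le)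
    obtain ⟨answer', H', hH', hr₂⟩ := hC₁.reaches_of_halted (φ := φ) ht.1 (hclock t le_rfl)
    refine ⟨answer', H', hH', ?_⟩
    push_cast
    exact (((hr.trans hr₁).trans hr₂).trans (reaches_grow hH')).mono (by omega)

/-- Every complete run uses at least one tick, so at most `L` runs fit. No halting assumption on `N`
enters. -/
theorem exists_completed (N : OracleMachine) (φ : StringFun) (L : ℕ) :
    ∃ k n, Completed N φ k n ∧ n ≤ L ∧ ∀ t, N.HaltsAt φ (powCode k) t → L < n + t + 1 := by
  by_contra! hcon
  have : ∀ k, ∃ n, Completed N φ k n ∧ n ≤ L := by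
    intro k
    induction k with
    | zero => exact ⟨0, .zero, Nat.zero_le _⟩
    | succ k ih =>
      obtain ⟨n, hn, hL⟩ := ih
      obtain ⟨t, ht, hL'⟩ := hcon k n hn hL
      exact ⟨_, hn.succ ht, hL'⟩
  obtain ⟨n, hn, hL⟩ := this (L + 1)
  have := hn.le
  omega

/-- The clocked machine halts in linear time and outputs the result of the last run of `N` that can be
completed in the time given by the length of the input. -/
theorem exists_reaches_halt (N : OracleMachine) (φ : StringFun) (a : List Letter) :
    ∃ k n, Completed N φ k n ∧ n ≤ a.length ∧
      (∀ t, N.HaltsAt φ (powCode k) t → a.length < n + t + 1) ∧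
      ∃ s ≤ 20 * a.length + 20, (machine N).HaltsAfter φ a s ∧
        IsResult N φ k (tapeContent (((machine N).run φ a s).tape .output)) := by
  obtain ⟨k, n, hkn, hn, hmax⟩ := exists_completed N φ a.length
  refine ⟨k, n, hkn, hn, hmax, ?_⟩
  suffices h : ∃ C, (machine N).ReachesIn φ (20 * a.length + 20) ((machine N).init a) C ∧
      C.state = (machine N).halt ∧ IsResult N φ k (tapeContent (C.tape .output)) by
    obtain ⟨_, ⟨s, hs, rfl⟩, h1, h2⟩ := h
    exact ⟨s, hs, h1, h2⟩
  obtain ⟨answer, H, hH, hr⟩ := hkn.reaches hn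
  obtain ⟨d, hd⟩ := Nat.exists_eq_add_of_le hn
  obtain ⟨C₁, hC₁, hr₁⟩ := (simulating_start (a := a) (final := false) (k := k) (i := n)
    (answer := answer) hH).run (φ := φ) d
    -- A halt before the clock expires would leave the tick needed to complete this run, against
    -- maximality.
    (fun m hm hhalt => by
      obtain ⟨t, htm, ht⟩ := hhalt.exists_haltsAt
      have := hmax t ht
      omega)
    (.inr fun m hm => by
      rw [← Nat.cast_add, isNone_writtenTape]
      simp
      omega)
  -- The clock head is now on the first blank. Expiry is tested before halting, so a run that halts
  -- exactly here does not count as complete.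
  obtain ⟨answer', H', hH', hr₂⟩ := hC₁.reaches_of_expired (φ := φ) (by
    rw [← Nat.cast_add, isNone_writtenTape]
    simp
    omega)
  have hr₃ := (hr.trans hr₁).trans hr₂
  cases hkn with
  | zero =>
    obtain ⟨C, hC, hhalt, hout⟩ := reaches_halt_of_none (φ := φ) (a := a)
      (i := ((0 : ℕ) : ℤ) + d) (answer := answer') hH'
    exact ⟨C, (hr₃.trans hC).mono (by omega), hhalt, hout⟩
  | @succ k n t _ ht =>
    -- The untimed repetition stays linear: `t` is below the length of the input, since this run was
    -- once completed within the clock.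
    obtain ⟨C₂, hC₂, hr₄⟩ := (simulating_start (a := a) (final := true) (k := k)
      (i := ((n + t + 1 : ℕ) : ℤ) + d) (answer := answer') hH').run (φ := φ) t ht.2 (.inl rfl)
    obtain ⟨C, hC, hhalt, hout⟩ := hC₂.reaches_halt (φ := φ) ht.1
    exact ⟨C, (((hr₃.trans (reaches_shrink hH')).trans hr₄).trans hC).mono (by omega), hhalt,
      t, ht.1, hout.symm⟩

end Clocked

/-! ### Second-order polynomials -/

namespace IsSecondOrderPolynomial

theorem const (c : ℕ) : IsSecondOrderPolynomial fun _ _ => c := by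
  simpa using poly (Polynomial.C c)

theorem monotone {P : (ℕ → ℕ) → ℕ → ℕ} (hP : IsSecondOrderPolynomial P) {l : ℕ → ℕ}
    (hl : Monotone l) : Monotone (P l) := by
  induction hP with
  | poly p =>
    intro m n hmn
    simp only [Polynomial.eval_eq_sum_range]
    gcongr
  | app _ ih => exact hl.comp ih
  | add _ _ ih₁ ih₂ => exact ih₁.add ih₂
  | mul _ _ ih₁ ih₂ => exact fun m n hmn => Nat.mul_le_mul (ih₁ hmn) (ih₂ hmn)

theorem comp {P Q : (ℕ → ℕ) → ℕ → ℕ} (hP : IsSecondOrderPolynomial P)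
    (hQ : IsSecondOrderPolynomial Q) : IsSecondOrderPolynomial fun l n => P l (Q l n) := by
  induction hP with
  | poly p =>
    induction p using Polynomial.induction_on' with
    | add p q hp hq => simpa using hp.add hq
    | monomial d c =>
      simp only [Polynomial.eval_monomial]
      refine (const c).mul ?_
      induction d with
      | zero => simpa using const 1
      | succ d ih => simpa only [pow_succ] using ih.mul hQ
  | app _ ih => exact ih.app
  | add _ _ ih₁ ih₂ => exact ih₁.add ih₂
  | mul _ _ ih₁ ih₂ => exact ih₁.mul ih₂

end IsSecondOrderPolynomial

/-! ### Delayed interval names -/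

/-- A coded finite interval has nonnegative radius, so its endpoints belong to it and inclusion
compares them. -/
theorem IsIntervalCode.diam_le_of_subset {s : List Letter} {I J : CodedInterval}
    (hI : IsIntervalCode s I) (h : I.toSet ⊆ J.toSet) : I.diam ≤ J.diam := by
  cases J with
  | infinite => exact le_top
  | finite r ε =>
    cases hI with
    | infinite =>
      have := h (Set.mem_univ ((r : ℝ) + ε + 1))
      simp only [CodedInterval.toSet, Set.mem_Icc] at this
      linarith [this.2]
    | @finite a b r' ε' ha hb hε =>
      have hε' : (0 : ℝ) ≤ ε' := by exact_mod_cast hε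
      have h1 := h (Set.left_mem_Icc.2 (by linarith : (r' : ℝ) - ε' ≤ r' + ε'))
      have h2 := h (Set.right_mem_Icc.2 (by linarith : (r' : ℝ) - ε' ≤ r' + ε'))
      refine WithTop.coe_le_coe.2 ?_
      have : (2 * ε' : ℝ) ≤ 2 * ε := by linarith [h1.1, h2.2]
      exact_mod_cast this

/-- A name determines both its interval sequence and its point, so the choices in `intervalParam`
disappear. -/
theorem intervalParam_eq {ψ : StringFun} {I : ℕ → CodedInterval} {x : ℝ}
    (hI : EncodesIntervals ψ I) (hx : IsIntervalName ψ x) (n : ℕ) :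
    intervalParam ψ n = sInf {N | (I N).diam ≤ (((2 : ℚ) ^ n)⁻¹ : ℚ)} +
      ⌈Real.logb 2 (|x| + 1)⌉₊ := by
  have h1 : {N | ∃ J, EncodesIntervals ψ J ∧ (J N).diam ≤ (((2 : ℚ) ^ n)⁻¹ : ℚ)} =
      {N | (I N).diam ≤ (((2 : ℚ) ^ n)⁻¹ : ℚ)} := by
    ext N
    exact ⟨fun ⟨J, hJ, h⟩ => hI.functional hJ ▸ h, fun h => ⟨I, hI, h⟩⟩
  have h2 := mem_intervalRep.2 hx
  rw [intervalParam, h1, Part.getOrElse, dif_pos h2.fst, Part.get_eq_of_mem h2]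

namespace Clocked

open OracleMachine

/-- The intervals known after `k` complete runs. -/
def delayedInterval (I : ℕ → CodedInterval) : ℕ → CodedInterval
  | 0 => .infinite
  | k + 1 => I k

def delayedValue (ψ : StringFun) : ℕ → List Letter
  | 0 => []
  | k + 1 => ψ (powCode k)

/-- At length `L` the index in use is the largest `k` with `T k ≤ L`. It is monotone and unbounded
in `L`, so nesting and intersection survive the delay, and by length `T (N + 1)` the interval `I N`
has been reached. -/
theorem exists_delayed {ψ ψ' : StringFun} {I : ℕ → CodedInterval} {x : ℝ} {T : ℕ → ℕ}
    (hT : StrictMono T) (hI : EncodesIntervals ψ I)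
    (hnest : ∀ n, (I (n + 1)).toSet ⊆ (I n).toSet) (hx : ⋂ n, (I n).toSet = {x})
    (hψ' : ∀ a, ∃ k, T k ≤ a.length ∧ a.length < T (k + 1) ∧ ψ' a = delayedValue ψ k) :
    IsIntervalName ψ' x ∧ ∃ J, EncodesIntervals ψ' J ∧
      ∀ N, (J (T (N + 1))).diam ≤ (I N).diam := by
  have hcode : ∀ k, IsIntervalCode (ψ (powCode k)) (I k) := fun k => hI k _ (isIntCode_two_pow k)
  -- A code of `2 ^ n` has length `n + 2`.
  have hk : ∀ n : ℕ, ∃ k, T k ≤ n + 2 ∧ n + 2 < T (k + 1) := fun n => by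
    obtain ⟨k, h1, h2, -⟩ := hψ' (powCode n)
    simp only [powCode, List.length_cons, List.length_replicate] at h1 h2
    exact ⟨k, h1, h2⟩
  choose κ hκ₁ hκ₂ using hk
  have hlt : ∀ {j n}, T j ≤ n + 2 → j ≤ κ n := fun {j n} h =>
    Nat.lt_succ_iff.1 (hT.lt_iff_lt.1 (h.trans_lt (hκ₂ n)))
  have hκ : ∀ n, κ n ≤ κ (n + 1) := fun n => hlt ((hκ₁ n).trans (by omega))
  have hanti : Antitone fun k => (delayedInterval I k).toSet := by
    refine antitone_nat_of_succ_le fun k => ?_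
    cases k with
    | zero => exact Set.subset_univ _
    | succ k => exact hnest k
  have hlate : ∀ N, N + 1 ≤ κ (T (N + 1)) := fun N => hlt (by omega)
  let J : ℕ → CodedInterval := fun n => delayedInterval I (κ n)
  have hJ : EncodesIntervals ψ' J := by
    intro n a ha
    obtain ⟨k, h1, h2, h3⟩ := hψ' a
    rw [ha.length_eq] at h1 h2
    have hkn : k = κ n :=
      le_antisymm (hlt h1) (Nat.lt_succ_iff.1 (hT.lt_iff_lt.1 ((hκ₁ n).trans_lt h2)))
    change IsIntervalCode (ψ' a) (delayedInterval I (κ n))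
    rw [h3, hkn]
    cases κ n with
    | zero => exact .infinite
    | succ k => exact hcode k
  refine ⟨⟨J, hJ, fun n => hanti (hκ n), ?_⟩, J, hJ, fun N => ?_⟩
  · rw [← hx]
    refine subset_antisymm (fun z hz => Set.mem_iInter.2 fun N => ?_)
      fun z hz => Set.mem_iInter.2 fun n => ?_
    · exact hanti (hlate N) (Set.mem_iInter.1 hz (T (N + 1)))
    · change z ∈ (delayedInterval I (κ n)).toSet
      cases κ n with
      | zero => exact Set.mem_univ _
      | succ k => exact Set.mem_iInter.1 hz k
  · refine (hJ _ _ (isIntCode_two_pow _)).diam_le_of_subset ?_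
    exact hanti (hlate N)

/-! ### The delay caused by the clock -/

/-- The time needed for the runs on the codes of `2 ^ i` with `i < k`. -/
def totalTime (t : ℕ → ℕ) (k : ℕ) : ℕ := ∑ i ∈ Finset.range k, (t i + 1)

theorem totalTime_strictMono (t : ℕ → ℕ) : StrictMono (totalTime t) :=
  strictMono_nat_of_lt_succ fun k => by
    rw [totalTime, totalTime, Finset.sum_range_succ]
    omega

theorem Completed.eq_totalTime {N : OracleMachine} {φ : StringFun} {t : ℕ → ℕ}
    (ht : ∀ k, N.HaltsAt φ (powCode k) (t k)) {k n : ℕ} (h : Completed N φ k n) :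
    n = totalTime t k := by
  induction h with
  | zero => rfl
  | @succ k n s _ hs ih =>
    rw [totalTime, Finset.sum_range_succ, ← totalTime, ← ih, hs.unique (ht k), add_assoc]

theorem value_of_mem_operator {N : OracleMachine} {φ ψ ψ' : StringFun} {t : ℕ → ℕ}
    (ht : ∀ k, N.HaltsAt φ (powCode k) (t k)) (hψ : ψ ∈ N.operator φ)
    (hψ' : ψ' ∈ (machine N).operator φ) (a : List Letter) :
    ∃ k, totalTime t k ≤ a.length ∧ a.length < totalTime t (k + 1) ∧
      ψ' a = delayedValue ψ k := by
  obtain ⟨k, n, hkn, hn, hmax, s, -, hs, hres⟩ := exists_reaches_halt N φ a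
  obtain ⟨s', hs', hout⟩ := mem_operator_iff.1 hψ' a
  rw [run_eq_run_of_haltsAfter hs' hs, hout] at hres
  obtain rfl := hkn.eq_totalTime ht
  refine ⟨k, hn, ?_, ?_⟩
  · rw [totalTime, Finset.sum_range_succ, ← totalTime, ← add_assoc]
    exact hmax _ (ht k)
  · cases k with
    | zero => exact hres
    | succ k =>
      obtain ⟨m, hm, e⟩ := hres
      obtain ⟨m', hm', e'⟩ := mem_operator_iff.1 hψ (powCode k)
      change _ = ψ (powCode k)
      rw [← e, ← e', run_eq_run_of_haltsAfter hm hm']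

theorem exists_mem_operator (N : OracleMachine) (φ : StringFun) :
    ∃ ψ, ψ ∈ (machine N).operator φ := by
  have h : ∀ a, ∃ s, (machine N).HaltsAfter φ a s := fun a =>
    let ⟨_, _, _, _, _, s, _, hs, _⟩ := exists_reaches_halt N φ a
    ⟨s, hs⟩
  choose s hs using h
  exact ⟨fun a => tapeContent (((machine N).run φ a (s a)).tape .output),
    mem_operator_iff.2 fun a => ⟨s a, hs a, rfl⟩⟩

theorem exists_haltsAt_powCode {N : OracleMachine} {φ ψ : StringFun} (hψ : ψ ∈ N.operator φ) :
    ∃ t : ℕ → ℕ, ∀ k, N.HaltsAt φ (powCode k) (t k) := by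
  have h : ∀ k, ∃ t, N.HaltsAt φ (powCode k) t := fun k =>
    let ⟨_, hn, _⟩ := mem_operator_iff.1 hψ (powCode k)
    let ⟨t, _, ht⟩ := hn.exists_haltsAt
    ⟨t, ht⟩
  exact ⟨_, fun k => (h k).choose_spec⟩

/-- Both names denote `y`, so the logarithmic terms agree and only the index is delayed: precision
reached by `ψ` at `N` is reached by `ψ'` no later than `totalTime t (N + 1)`. -/
theorem intervalParam_le {N : OracleMachine} {φ ψ ψ' : StringFun} {y : ℝ} {t : ℕ → ℕ}
    (ht : ∀ k, N.HaltsAt φ (powCode k) (t k)) (hψ : ψ ∈ N.operator φ) (hy : IsIntervalName ψ y)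
    (hψ' : ψ' ∈ (machine N).operator φ) (n : ℕ) :
    intervalParam ψ' n ≤ totalTime t (intervalParam ψ n + 1) + intervalParam ψ n := by
  obtain ⟨I, hI, hnest, hx⟩ := hy
  obtain ⟨hy', J, hJ, hdiam⟩ := exists_delayed (totalTime_strictMono t) hI hnest hx
    (value_of_mem_operator ht hψ hψ')
  rw [intervalParam_eq hI ⟨I, hI, hnest, hx⟩, intervalParam_eq hJ hy']
  have hne := IsIntervalName.exists_diam_le hnest hx (by positivity : (0 : ℚ) < ((2 : ℚ) ^ n)⁻¹)
  have hmem : (I (sInf {N | (I N).diam ≤ (((2 : ℚ) ^ n)⁻¹ : ℚ)})).diam ≤ (((2 : ℚ) ^ n)⁻¹ : ℚ) :=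
    Nat.sInf_mem (s := {N | (I N).diam ≤ (((2 : ℚ) ^ n)⁻¹ : ℚ)}) hne
  -- The logarithmic term is bounded by the whole parameter of `ψ`.
  refine Nat.add_le_add ?_ (Nat.le_add_left _ _)
  refine (Nat.sInf_le (s := {N | (J N).diam ≤ (((2 : ℚ) ^ n)⁻¹ : ℚ)})
    ((hdiam _).trans hmem)).trans ?_
  exact (totalTime_strictMono t).monotone (by omega)

end Clocked

theorem mainTheorem6 (f : ℝ →. ℝ) (hf : IsPolytimeComputable intervalReals intervalReals f) :
    ∃ (M : OracleMachine) (C : ℕ) (P : (ℕ → ℕ) → ℕ → ℕ),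
      IsSecondOrderPolynomial P ∧
      IsRealiser intervalReals intervalReals M.operator f ∧
      (∀ (φ : StringFun) (a : List Letter), M.time φ a ≤ ((C * a.length + C : ℕ) : ℕ∞)) ∧
      BlowupBoundedBy intervalReals intervalReals M f P := by
  obtain ⟨N, P, Q, hP, hQ, hreal, htime, hblow⟩ := hf
  -- At most `Q l n + 1` runs are needed, on codes of length at most `Q l n + 2`, each using one
  -- tick beyond its running time; the last `Q l n` covers the logarithmic term.
  refine ⟨Clocked.machine N, 20, fun l n => (Q l n + 1) * (P l (Q l n + 2) + 1) + Q l n,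
    ((hQ.add (.const 1)).mul ((hP.comp (hQ.add (.const 2))).add (.const 1))).add hQ, ?_, ?_, ?_⟩
  · intro φ x y hx hy
    obtain ⟨ψ, hψ, hyψ⟩ := hreal φ x y hx hy
    obtain ⟨t, ht⟩ := Clocked.exists_haltsAt_powCode hψ
    obtain ⟨ψ', hψ'⟩ := Clocked.exists_mem_operator N φ
    obtain ⟨I, hI, hnest, hIy⟩ := mem_intervalRep.1 hyψ
    exact ⟨ψ', hψ', mem_intervalRep.2 (Clocked.exists_delayed (Clocked.totalTime_strictMono t) hI hnest hIy
      (Clocked.value_of_mem_operator ht hψ hψ')).1⟩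
  · intro φ a
    obtain ⟨_, _, _, _, _, s, hs, hhalt, _⟩ := Clocked.exists_reaches_halt N φ a
    exact (OracleMachine.time_le_of_haltsAfter hhalt).trans (Nat.cast_le.2 hs)
  · intro φ x hx hdom ψ' hψ' n
    obtain ⟨ψ, hψ, hyψ⟩ := hreal φ x _ hx (Part.get_mem hdom)
    obtain ⟨t, ht⟩ := Clocked.exists_haltsAt_powCode hψ
    let l := intervalReals.param φ
    have hl : Monotone l := monotone_nat_of_le_succ (intervalReals.param_mono φ hx.fst)
    have hle : intervalParam ψ n ≤ Q l n := hblow φ x hx hdom ψ hψ n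
    have htP : ∀ i, t i ≤ P l (i + 2) := by
      intro i
      have h := htime φ x hx hdom (Clocked.powCode i)
      simp only [Clocked.powCode, List.length_cons, List.length_replicate] at h
      obtain ⟨m, hm, hhalt⟩ := OracleMachine.exists_haltsAfter_of_time_le h
      refine le_trans ?_ hm
      by_contra! hlt
      exact (ht i).2 m hlt hhalt
    have htotal : Clocked.totalTime t (Q l n + 1) ≤ (Q l n + 1) * (P l (Q l n + 2) + 1) := by
      refine (Finset.sum_le_card_nsmul _ _ (P l (Q l n + 2) + 1) fun i hi => ?_).trans (by simp)
      rw [Finset.mem_range] at hi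
      -- Monotonicity of the parameter is needed here, to bound all runs by the time for the longest
      -- code.
      exact Nat.add_le_add_right ((htP i).trans (hP.monotone hl (by omega))) 1
    refine (Clocked.intervalParam_le ht hψ (mem_intervalRep.1 hyψ) hψ' n).trans ?_
    exact Nat.add_le_add (((Clocked.totalTime_strictMono t).monotone (by omega)).trans htotal) hle
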